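/- Let $K_0$ be the algebra of germs at $0$ of complex-valued analytic functions, i.e. of power series in $t$ with complex coefficients that converge absolutely for all sufficiently small $t$. For $0\ne f\in K_0$ let $\mathrm{ord}(f)$ be the order of vanishing of $f$ at $0$; for a nonzero formal power series in nonnegative fractional powers of $t$ (exponents in $\frac1n\{0,1,2,\dots\}$ for some $n\ge 1$) let $\mathrm{ord}$ be its smallest exponent. Elements of $K_0$ are identified with their Taylor series. Let $Q(z)=z^m+q_{m-1}z^{m-1}+\dots+q_0\in K_0[z]$ be monic of degree $m\ge 1$ with $q_0\neq 0$. Its Newton polygon is the convex hull in $\mathbb{R}^2$ of the points $(j,\mathrm{ord}(q_j))$, $0\le j\le m$, $q_j\ne0$ (with $q_m=1$). Let $(x_0,y_0)=(0,\mathrm{ord}(q_0)),(x_1,y_1),\dots,(x_k,y_k)=(m,0)$ be the extreme points met when its boundary is traversed counterclockwise from $(0,\mathrm{ord}(q_0))$ to $(m,0)$, and put $m_j=x_j-x_{j-1}$ and $s_j=(y_j-y_{j-1})/m_j$ for $1\le j\le k$. (a) If $Q$ is irreducible in $K_0[z]$, then $k=1$ and $m_1=m$, and there are a nonzero germ $\eta\in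 K_0$ with $\mathrm{ord}(\eta)=y_0-y_1=\mathrm{ord}(q_0)$ and formal power series $\eta_1,\dots,\eta_m$ in nonnegative fractional powers of $t$ such that $Q(t,z)=\prod_{\ell=1}^m(z-\eta_\ell(t))$, the $\eta_1,\dots,\eta_m$ are, with multiplicity, exactly the roots of $Q$ of order $-s_1$, and $\eta_\ell(t^m)=\eta(e^{2\pi i\ell/m}t)$ for $\ell=1,\dots,m$. (b) For every such $Q$ (irreducible or not) and every $j=1,\dots,k$, $Q$ has exactly $m_j$ roots $\eta_1,\dots,\eta_{m_j}$, counted with multiplicity, among the formal power series in nonnegative fractional powers of $t$ that satisfy $\mathrm{ord}(\eta_\ell)=-s_j$, and $\prod_{\ell=1}^{m_j}(z-\eta_\ell(t))\in K_0[z]$. -/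

import Mathlib

open Polynomial

noncomputable section

namespace NewtonPuiseux

/-- The algebra `K₀` of germs at `0` of (complex valued) analytic functions: the power series
`∑ aₙ tⁿ` with complex coefficients which converge absolutely for `t` sufficiently small. -/
def K0 : Subalgebra ℂ (PowerSeries ℂ) where
  carrier := {f | ∃ δ : ℝ, 0 < δ ∧ ∀ t : ℂ, ‖t‖ < δ →
    Summable fun n : ℕ => ‖PowerSeries.coeff n f * t ^ n‖}
  mul_mem' := by
    rintro f g ⟨δ, hδ, hf⟩ ⟨ε, hε, hg⟩
    refine ⟨min δ ε, lt_min hδ hε, fun t ht => ?_⟩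
    have h := summable_norm_sum_mul_antidiagonal_of_summable_norm
      (hf t (lt_of_lt_of_le ht (min_le_left _ _))) (hg t (lt_of_lt_of_le ht (min_le_right _ _)))
    refine h.congr fun n => ?_
    rw [PowerSeries.coeff_mul, Finset.sum_mul]
    congr 1
    refine Finset.sum_congr rfl fun p hp => ?_
    rw [← Finset.HasAntidiagonal.mem_antidiagonal.mp hp, pow_add]
    ring
  add_mem' := by
    rintro f g ⟨δ, hδ, hf⟩ ⟨ε, hε, hg⟩
    refine ⟨min δ ε, lt_min hδ hε, fun t ht => ?_⟩
    have h := (hf t (lt_of_lt_of_le ht (min_le_left _ _))).add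
      (hg t (lt_of_lt_of_le ht (min_le_right _ _)))
    refine h.of_nonneg_of_le (fun n => norm_nonneg _) fun n => ?_
    rw [map_add, add_mul]
    exact norm_add_le _ _
  algebraMap_mem' := by
    intro c
    refine ⟨1, one_pos, fun t _ => ?_⟩
    refine summable_of_ne_finset_zero (s := {0}) fun n hn => ?_
    have hn' : n ≠ 0 := by simpa using hn
    simp [PowerSeries.coeff_C, hn']

/-- The order of vanishing at `0` of a germ `f` (meaningful for `f ≠ 0`). -/
def ord (f : K0) : ℕ := (f : PowerSeries ℂ).order.toNat

/-- The germ `t ↦ f (a t)`, for a complex number `a`. -/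
def dilate (a : ℂ) (f : K0) : K0 :=
  ⟨PowerSeries.rescale a (f : PowerSeries ℂ), by
    obtain ⟨δ, hδ, hf⟩ := f.2
    have ha : 0 < ‖a‖ + 1 := by positivity
    refine ⟨δ / (‖a‖ + 1), by positivity, fun t ht => ?_⟩
    have hat : ‖a * t‖ < δ := by
      rw [lt_div_iff₀ ha] at ht
      rw [norm_mul]
      nlinarith [norm_nonneg t, norm_nonneg a]
    refine (hf (a * t) hat).congr fun n => ?_
    rw [PowerSeries.coeff_rescale, mul_pow]
    congr 1
    ring⟩

/-- The ring of formal power series in `t` with nonnegative fractional powers: the formal sums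
`∑ a_q t^q` whose exponents `q` lie in `{0, 1/n, 2/n, 3/n, ...}` for some positive integer `n`. -/
def Puiseux : Subring (HahnSeries ℚ ℂ) where
  carrier := {f | ∃ n : ℕ, 0 < n ∧ ∀ q ∈ f.support, ∃ i : ℕ, q = (i : ℚ) / (n : ℚ)}
  mul_mem' := by
    rintro f g ⟨n, hn, hf⟩ ⟨k, hk, hg⟩
    refine ⟨n * k, Nat.mul_pos hn hk, fun q hq => ?_⟩
    obtain ⟨a, ha, b, hb, rfl⟩ := Set.mem_add.mp (HahnSeries.support_mul_subset hq)
    obtain ⟨i, rfl⟩ := hf a ha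
    obtain ⟨j, rfl⟩ := hg b hb
    refine ⟨i * k + n * j, ?_⟩
    push_cast
    rw [div_add_div _ _ (by positivity) (by positivity)]
  one_mem' := by
    refine ⟨1, one_pos, fun q hq => ⟨0, ?_⟩⟩
    by_contra h
    exact hq (by simpa [HahnSeries.coeff_one] using h)
  add_mem' := by
    rintro f g ⟨n, hn, hf⟩ ⟨k, hk, hg⟩
    refine ⟨n * k, Nat.mul_pos hn hk, fun q hq => ?_⟩
    have hn' : (n : ℚ) ≠ 0 := by positivity
    have hk' : (k : ℚ) ≠ 0 := by positivity
    rcases HahnSeries.support_add_subset f g hq with h | h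
    · obtain ⟨i, rfl⟩ := hf q h
      exact ⟨i * k, by push_cast; field_simp⟩
    · obtain ⟨i, rfl⟩ := hg q h
      exact ⟨n * i, by push_cast; field_simp⟩
  zero_mem' := ⟨1, one_pos, fun q hq => absurd rfl hq⟩
  neg_mem' := by
    rintro f ⟨n, hn, hf⟩
    exact ⟨n, hn, fun q hq => hf q (by simpa using hq)⟩

/-- A germ, identified with the formal power series given by its Taylor expansion. -/
def toPuiseux : K0 →+* Puiseux :=
  ((HahnSeries.ofPowerSeries ℚ ℂ).comp K0.val.toRingHom).codRestrict Puiseux (by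
    intro f
    refine ⟨1, one_pos, fun q hq => ?_⟩
    have h : q ∈ (HahnSeries.embDomain (Nat.castOrderEmbedding (α := ℚ))
        (HahnSeries.toPowerSeries.symm (f : PowerSeries ℂ))).support := hq
    obtain ⟨i, -, rfl⟩ := HahnSeries.support_embDomain_subset h
    exact ⟨i, by simp⟩)

/-- The substitution `f(t) ↦ f(t^m)` for a positive integer `m`, on formal power series in
nonnegative fractional powers of `t`: all exponents are multiplied by `m`. -/
def substPow (m : ℕ) (hm : 0 < m) : Puiseux →+* Puiseux :=
  ((HahnSeries.embDomainRingHom (AddMonoidHom.mulLeft (m : ℚ))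
      (mul_right_injective₀ (Nat.cast_ne_zero.mpr hm.ne'))
      (fun _ _ => mul_le_mul_iff_right₀ (Nat.cast_pos.mpr hm))).comp
    Puiseux.subtype).codRestrict Puiseux (by
      rintro ⟨f, n, hn, hf⟩
      refine ⟨n, hn, fun q hq => ?_⟩
      obtain ⟨a, ha, rfl⟩ := HahnSeries.support_embDomain_subset hq
      obtain ⟨i, rfl⟩ := hf a ha
      exact ⟨m * i, by simp [mul_div_assoc]⟩)

/-! ### The Newton polygon -/

/-- The points `(j, ord q_j)`, `0 ≤ j ≤ deg Q`, `q_j ≠ 0`, where `Q = ∑ q_j z^j`. -/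
def points (Q : K0[X]) : Set (ℝ × ℝ) :=
  {p | ∃ j : ℕ, j ≤ Q.natDegree ∧ Q.coeff j ≠ 0 ∧ p = ((j : ℝ), (ord (Q.coeff j) : ℝ))}

/-- The Newton polygon of `Q`. -/
def newtonPolygon (Q : K0[X]) : Set (ℝ × ℝ) := convexHull ℝ (points Q)

/-- The extreme points of the Newton polygon which are met when its boundary is traversed
counterclockwise from its leftmost point `(0, ord q_0)` to its rightmost point `(deg Q, 0)`:
the extreme points on the lower boundary. -/
def lowerVertices (Q : K0[X]) : Set (ℝ × ℝ) :=
  {p | p ∈ (newtonPolygon Q).extremePoints ℝ ∧ ∀ y : ℝ, (p.1, y) ∈ newtonPolygon Q → p.2 ≤ y}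

/-- The abscissae of the lower vertices. Every extreme point of the Newton polygon is
one of the points `(j, ord q_j)`, so no vertex is lost. -/
def abscissae (Q : K0[X]) : Finset ℕ :=
  open Classical in
  (Finset.range (Q.natDegree + 1)).filter fun j =>
    Q.coeff j ≠ 0 ∧ ((j : ℝ), (ord (Q.coeff j) : ℝ)) ∈ lowerVertices Q

/-- The number `k` of (lower) edges of the Newton polygon; there are `k + 1` lower vertices. -/
def numEdges (Q : K0[X]) : ℕ := (abscissae Q).card - 1

/-- The abscissa `x_j` of the `j`-th lower vertex, `0 ≤ j ≤ k`, counted from left to right. -/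
def vertexX (Q : K0[X]) (j : ℕ) : ℕ := Nat.nth (fun i => i ∈ abscissae Q) j

/-- The ordinate `y_j` of the `j`-th lower vertex, `0 ≤ j ≤ k`. -/
def vertexY (Q : K0[X]) (j : ℕ) : ℕ := ord (Q.coeff (vertexX Q j))

/-- The horizontal length `m_j = x_j - x_{j-1}` of the `j`-th edge, `1 ≤ j ≤ k`. -/
def edgeLength (Q : K0[X]) (j : ℕ) : ℕ := vertexX Q j - vertexX Q (j - 1)

/-- The slope `s_j = (y_j - y_{j-1}) / m_j` of the `j`-th edge, `1 ≤ j ≤ k`. -/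
def edgeSlope (Q : K0[X]) (j : ℕ) : ℚ :=
  ((vertexY Q j : ℚ) - (vertexY Q (j - 1) : ℚ)) / (edgeLength Q j : ℚ)

/-- The roots, listed with multiplicity, of `Q` in the ring of formal power series in nonnegative
fractional powers of `t` whose order (smallest exponent) is `-s_j`. -/
def edgeRoots (Q : K0[X]) (j : ℕ) : Multiset Puiseux :=
  open Classical in
  (Q.map toPuiseux).roots.filter fun ρ =>
    (ρ : HahnSeries ℚ ℂ).orderTop = ((-edgeSlope Q j : ℚ) : WithTop ℚ)

end NewtonPuiseux

end

namespace NewtonPuiseux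

/-! Three ideas carry the proof.

Splitting (`exists_splits_expand`). Every monic polynomial over `K0` splits after a substitution of
`t ^ n` for `t`. A shift of the variable removes the subleading coefficient. Ramifying and rescaling
by the extremal slope then gives a reduction at `t = 0` whose roots sum to zero but are not all
zero, hence has two coprime factors. Hensel's lemma (`exists_factors_of_isCoprime`) lifts them, and
induction on the degree finishes. Convergence comes for free, since Hensel is deduced from the
analytic inverse function theorem: multiplication of monic polynomials has an invertible derivative
at a coprime pair.

Counting (`card_edgeRoots`). For a product of factors `X - C r`, the supporting line of slope `-lam`
touches between the number of roots of order `> lam` and the number of order `≥ lam`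
(`exists_touches_prod`). The line through an edge of the polygon touches only between its two ends
(`support_line_of_consecutive`). Comparing the two counts the roots of each order.

Descent (`exists_map_expand_eq_prod`). For a primitive `n`-th root of unity `ζ`, the action `t ↦ ζ
t` permutes the roots of the ramified polynomial and preserves orders, and its fixed germs are
exactly the series in `t ^ n`. An invariant multiset of roots therefore defines a polynomial over
`K0`. Applied to all roots of one order, this gives (b). If `Q` is irreducible, a single orbit
already gives all of `Q`; so all roots have the same order, there is one edge, and the stabilizer of
a root shows that it is a series in `t ^ (n / m)`, where `m` is the degree, which yields `η`
(`exists_roots_eq_orbit`). -/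

/-! ### Convergent germs and their substitutions. -/

theorem mem_K0_iff {f : PowerSeries ℂ} :
    f ∈ K0 ↔ ∃ r : ℝ, 0 < r ∧ Summable fun n : ℕ => ‖PowerSeries.coeff n f‖ * r ^ n := by
  constructor
  · rintro ⟨δ, hδ, h⟩
    refine ⟨δ / 2, by positivity, (h ((δ / 2 : ℝ) : ℂ) ?_).congr fun n => ?_⟩
    · rw [Complex.norm_real, Real.norm_of_nonneg (by positivity)]; linarith
    · rw [norm_mul, norm_pow, Complex.norm_real, Real.norm_of_nonneg (by positivity)]
  · rintro ⟨r, hr, h⟩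
    refine ⟨r, hr, fun t ht => h.of_nonneg_of_le (fun n => norm_nonneg _) fun n => ?_⟩
    rw [norm_mul, norm_pow]
    gcongr

theorem mem_K0_of_summable {f : PowerSeries ℂ} {r : ℝ} (hr : 0 < r)
    (h : Summable fun n : ℕ => ‖PowerSeries.coeff n f‖ * r ^ n) : f ∈ K0 :=
  mem_K0_iff.2 ⟨r, hr, h⟩

/-- The substitution `f(t) ↦ f(t ^ n)` on germs. -/
noncomputable def expand (n : ℕ) (hn : n ≠ 0) : K0 →+* K0 :=
  ((PowerSeries.expand n hn).toRingHom.comp K0.val.toRingHom).codRestrict K0.toSubring (by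
    intro f
    obtain ⟨r, hr, h⟩ := mem_K0_iff.1 f.2
    -- A radius at most `1` is needed so that raising the exponent from `m` to `n * m` does not
    -- increase the terms.
    have hs : 0 < min r 1 := lt_min hr one_pos
    refine mem_K0_of_summable hs ?_
    have hinj : Function.Injective fun m : ℕ => n * m := mul_right_injective₀ hn
    rw [← hinj.summable_iff]
    · refine h.of_nonneg_of_le (fun m => mul_nonneg (norm_nonneg _) (pow_nonneg hs.le _)) fun m => ?_
      change ‖PowerSeries.coeff (n * m) (PowerSeries.expand n hn (f : PowerSeries ℂ))‖ *
        min r 1 ^ (n * m) ≤ _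
      rw [PowerSeries.coeff_expand_mul]
      gcongr
      calc min r 1 ^ (n * m) ≤ min r 1 ^ m :=
            pow_le_pow_of_le_one hs.le (min_le_right _ _)
              (Nat.le_mul_of_pos_left _ (Nat.pos_of_ne_zero hn))
        _ ≤ r ^ m := by gcongr; exact min_le_left _ _
    · intro m hm
      change ‖PowerSeries.coeff m (PowerSeries.expand n hn (f : PowerSeries ℂ))‖ * _ = 0
      rw [PowerSeries.coeff_expand_of_not_dvd, norm_zero, zero_mul]
      rintro ⟨k, rfl⟩
      exact hm ⟨k, rfl⟩)

@[simp] theorem coe_expand (n : ℕ) (hn : n ≠ 0) (f : K0) :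
    (expand n hn f : PowerSeries ℂ) = PowerSeries.expand n hn f := rfl

theorem expand_injective (n : ℕ) (hn : n ≠ 0) : Function.Injective (expand n hn) := by
  intro f g h
  ext m
  have := congrArg (fun x : K0 => PowerSeries.coeff (n * m) (x : PowerSeries ℂ)) h
  simpa using this

theorem expand_expand (n k : ℕ) (hn : n ≠ 0) (hk : k ≠ 0) (f : K0) :
    expand n hn (expand k hk f) = expand (n * k) (mul_ne_zero hn hk) f := by
  ext m
  simp only [coe_expand, PowerSeries.coeff_expand]
  by_cases h : n ∣ m
  · obtain ⟨a, rfl⟩ := h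
    have hn' := Nat.pos_of_ne_zero hn
    simp [Nat.mul_div_cancel_left _ hn', Nat.mul_dvd_mul_iff_left hn',
      Nat.mul_div_mul_left _ _ hn']
  · rw [if_neg h, if_neg (fun h' => h ((dvd_mul_right n k).trans h'))]

theorem exists_expand_eq {n : ℕ} (hn : n ≠ 0) {f : K0}
    (h : ∀ m, ¬ n ∣ m → PowerSeries.coeff m (f : PowerSeries ℂ) = 0) :
    ∃ g : K0, expand n hn g = f := by
  obtain ⟨r, hr, hf⟩ := mem_K0_iff.1 f.2
  refine ⟨⟨PowerSeries.mk fun m => PowerSeries.coeff (n * m) (f : PowerSeries ℂ),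
    mem_K0_of_summable (pow_pos hr n) ?_⟩, ?_⟩
  · refine (hf.comp_injective (mul_right_injective₀ hn)).congr fun m => ?_
    simp [pow_mul]
  · ext m
    rw [coe_expand, PowerSeries.coeff_expand]
    split_ifs with hm
    · obtain ⟨k, rfl⟩ := hm
      simp [Nat.mul_div_cancel_left _ (Nat.pos_of_ne_zero hn)]
    · exact (h m hm).symm

/-- The germ of the coordinate function `t`. -/
noncomputable def coord : K0 := ⟨PowerSeries.X, mem_K0_of_summable one_pos <|
  summable_of_ne_finset_zero (s := {1}) fun n hn => by
    simp [PowerSeries.coeff_X, show n ≠ 1 by simpa using hn]⟩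

@[simp] theorem coe_coord : (coord : PowerSeries ℂ) = PowerSeries.X := rfl

theorem exists_eq_coord_pow_mul {f : K0} {k : ℕ} (h : (k : ℕ∞) ≤ (f : PowerSeries ℂ).order) :
    ∃ g : K0, f = coord ^ k * g := by
  obtain ⟨r, hr, hf⟩ := mem_K0_iff.1 f.2
  refine ⟨⟨PowerSeries.mk fun m => PowerSeries.coeff (m + k) (f : PowerSeries ℂ),
    mem_K0_of_summable hr ?_⟩, ?_⟩
  · have := ((summable_nat_add_iff k).2 hf).mul_left ((r ^ k)⁻¹)
    refine this.congr fun m => ?_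
    rw [PowerSeries.coeff_mk, pow_add]
    field_simp
  · ext m
    push_cast
    rw [coe_coord, PowerSeries.coeff_X_pow_mul']
    split_ifs with hm
    · simp [Nat.sub_add_cancel hm]
    · exact PowerSeries.coeff_of_lt_order _ (lt_of_lt_of_le (by exact_mod_cast not_le.1 hm) h)

/-- The substitution `f(t) ↦ f(a t)` on germs, as a ring homomorphism. -/
noncomputable def dilateHom (a : ℂ) : K0 →+* K0 :=
  ((PowerSeries.rescale a).comp K0.val.toRingHom).codRestrict K0.toSubring
    fun f => (dilate a f).2

@[simp] theorem dilateHom_apply (a : ℂ) (f : K0) : dilateHom a f = dilate a f := rfl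

@[simp] theorem coeff_dilate (a : ℂ) (f : K0) (m : ℕ) :
    PowerSeries.coeff m (dilate a f : PowerSeries ℂ) =
      a ^ m * PowerSeries.coeff m (f : PowerSeries ℂ) := PowerSeries.coeff_rescale _ _ _

theorem dilate_dilate (a b : ℂ) (f : K0) : dilate a (dilate b f) = dilate (a * b) f := by
  ext m
  simp [mul_pow, mul_assoc]

theorem iterate_dilateHom (a : ℂ) (k : ℕ) (f : K0) : (dilateHom a)^[k] f = dilate (a ^ k) f := by
  induction k with
  | zero => ext m; simp
  | succ k ih => rw [Function.iterate_succ_apply', ih, dilateHom_apply, dilate_dilate, pow_succ']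

theorem dilate_one (f : K0) : dilate 1 f = f := by
  ext m
  simp

theorem dilate_expand (a : ℂ) (n : ℕ) (hn : n ≠ 0) (f : K0) :
    dilate a (expand n hn f) = expand n hn (dilate (a ^ n) f) := by
  ext m
  rw [coeff_dilate, coe_expand, coe_expand, PowerSeries.coeff_expand, PowerSeries.coeff_expand]
  split_ifs with hm
  · obtain ⟨k, rfl⟩ := hm
    simp [Nat.mul_div_cancel_left _ (Nat.pos_of_ne_zero hn), pow_mul]
  · simp

/-- Invariance multiplies the `m`-th coefficient by `ζ ^ m` without changing it, so only exponents
divisible by `n` survive. This is the Galois descent used below. -/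
theorem exists_expand_eq_of_dilate_eq {n : ℕ} (hn : n ≠ 0) {ζ : ℂ} (hζ : IsPrimitiveRoot ζ n)
    {f : K0} (h : dilate ζ f = f) : ∃ g : K0, expand n hn g = f := by
  refine exists_expand_eq hn fun m hm => ?_
  have h1 := congrArg (fun x : K0 => PowerSeries.coeff m (x : PowerSeries ℂ)) h
  simp only [coeff_dilate] at h1
  by_contra h2
  exact hm (hζ.dvd_of_pow_eq_one m (mul_right_cancel₀ h2 (h1.trans (one_mul _).symm)))

/-! ### Germs in a root of `t` as fractional power series. -/

/-- The germ `f`, with `t ^ (1 / n)` substituted for `t`, as a fractional power series. -/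
noncomputable def substRoot (n : ℕ) (hn : n ≠ 0) : K0 →+* Puiseux :=
  (((HahnSeries.embDomainRingHom (AddMonoidHom.mulLeft ((n : ℚ)⁻¹))
      (mul_right_injective₀ (inv_ne_zero (Nat.cast_ne_zero.mpr hn)))
      (fun _ _ => mul_le_mul_iff_right₀
        (inv_pos.2 (Nat.cast_pos.mpr (Nat.pos_of_ne_zero hn))))).comp
    (HahnSeries.ofPowerSeries ℚ ℂ)).comp K0.val.toRingHom).codRestrict Puiseux (by
      intro f
      refine ⟨n, Nat.pos_of_ne_zero hn, fun q hq => ?_⟩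
      obtain ⟨a, ha, rfl⟩ := HahnSeries.support_embDomain_subset hq
      obtain ⟨i, -, rfl⟩ := HahnSeries.support_embDomain_subset ha
      exact ⟨i, by simp [div_eq_inv_mul]⟩)

theorem coeff_substRoot (n : ℕ) (hn : n ≠ 0) (f : K0) (i : ℕ) :
    (substRoot n hn f : HahnSeries ℚ ℂ).coeff ((i : ℚ) / n) =
      PowerSeries.coeff i (f : PowerSeries ℂ) := by
  rw [← HahnSeries.ofPowerSeries_apply_coeff (Γ := ℚ), div_eq_inv_mul]
  exact HahnSeries.embDomain_coeff (Γ' := ℚ)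
    (f := ⟨⟨_, mul_right_injective₀ (inv_ne_zero (Nat.cast_ne_zero.mpr hn))⟩,
      mul_le_mul_iff_right₀ (inv_pos.2 (Nat.cast_pos.mpr (Nat.pos_of_ne_zero hn)))⟩)

theorem coeff_substRoot_of_ne (n : ℕ) (hn : n ≠ 0) (f : K0) {q : ℚ}
    (hq : ∀ i : ℕ, q ≠ (i : ℚ) / n) : (substRoot n hn f : HahnSeries ℚ ℂ).coeff q = 0 := by
  by_contra h
  obtain ⟨a, ha, rfl⟩ := HahnSeries.support_embDomain_subset
    (show q ∈ HahnSeries.support (substRoot n hn f : HahnSeries ℚ ℂ) from h)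
  obtain ⟨i, -, rfl⟩ := HahnSeries.support_embDomain_subset ha
  exact hq i (by simp [div_eq_inv_mul])

theorem substRoot_injective (n : ℕ) (hn : n ≠ 0) : Function.Injective (substRoot n hn) := by
  intro f g h
  ext m
  rw [← coeff_substRoot n hn, ← coeff_substRoot n hn, h]

theorem toPuiseux_eq_substRoot (f : K0) : toPuiseux f = substRoot 1 one_ne_zero f := by
  ext q
  by_cases hq : ∃ i : ℕ, q = i
  · obtain ⟨i, rfl⟩ := hq
    have := coeff_substRoot 1 one_ne_zero f i
    rw [Nat.cast_one, div_one] at this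
    rw [this]
    exact HahnSeries.ofPowerSeries_apply_coeff _ _
  · push Not at hq
    rw [coeff_substRoot_of_ne 1 one_ne_zero f (by simpa using hq)]
    by_contra h
    obtain ⟨i, -, rfl⟩ := HahnSeries.support_embDomain_subset
      (show q ∈ HahnSeries.support (toPuiseux f : HahnSeries ℚ ℂ) from h)
    exact hq i (by simp)

theorem toPuiseux_injective : Function.Injective toPuiseux := by
  intro f g h
  rw [toPuiseux_eq_substRoot, toPuiseux_eq_substRoot] at h
  exact substRoot_injective _ _ h

/-- Compatibility of different ramification indices, which allows the index to be lowered when a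
root is a series in `t ^ k`. -/
theorem substRoot_mul_expand (n k : ℕ) (hn : n ≠ 0) (hk : k ≠ 0) (f : K0) :
    substRoot (n * k) (mul_ne_zero hn hk) (expand k hk f) = substRoot n hn f := by
  have hn' : (n : ℚ) ≠ 0 := Nat.cast_ne_zero.2 hn
  have hk' : (k : ℚ) ≠ 0 := Nat.cast_ne_zero.2 hk
  ext q
  by_cases hq : ∃ i : ℕ, q = (i : ℚ) / n
  · obtain ⟨i, rfl⟩ := hq
    rw [coeff_substRoot, show (i : ℚ) / n = ((k * i : ℕ) : ℚ) / ((n * k : ℕ) : ℚ) by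
      push_cast; field_simp, coeff_substRoot, coe_expand, PowerSeries.coeff_expand_mul]
  · push Not at hq
    rw [coeff_substRoot_of_ne n hn f hq]
    by_cases hq' : ∃ i : ℕ, q = (i : ℚ) / ((n * k : ℕ) : ℚ)
    · obtain ⟨i, rfl⟩ := hq'
      rw [coeff_substRoot, coe_expand, PowerSeries.coeff_expand_of_not_dvd]
      rintro ⟨j, rfl⟩
      exact hq j (by push_cast; field_simp)
    · push Not at hq'
      exact coeff_substRoot_of_ne _ _ _ hq'

theorem substRoot_expand (n : ℕ) (hn : n ≠ 0) (f : K0) :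
    substRoot n hn (expand n hn f) = toPuiseux f := by
  rw [toPuiseux_eq_substRoot, ← substRoot_mul_expand 1 n one_ne_zero hn]
  simp only [one_mul]

theorem substPow_substRoot (m : ℕ) (hm : 0 < m) (f : K0) :
    substPow m hm (substRoot m hm.ne' f) = toPuiseux f := by
  have hm' : (m : ℚ) ≠ 0 := Nat.cast_ne_zero.2 hm.ne'
  ext q
  have key : (substPow m hm (substRoot m hm.ne' f) : HahnSeries ℚ ℂ).coeff (m * (q / m)) =
      (substRoot m hm.ne' f : HahnSeries ℚ ℂ).coeff (q / m) :=
    HahnSeries.embDomain_coeff (Γ' := ℚ)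
      (f := ⟨⟨_, mul_right_injective₀ hm'⟩, mul_le_mul_iff_right₀ (Nat.cast_pos.mpr hm)⟩)
  rw [mul_div_cancel₀ _ hm'] at key
  rw [key, toPuiseux_eq_substRoot]
  by_cases hq : ∃ i : ℕ, q = (i : ℚ) / (1 : ℕ)
  · obtain ⟨i, rfl⟩ := hq
    rw [coeff_substRoot, Nat.cast_one, div_one, coeff_substRoot]
  · push Not at hq
    rw [coeff_substRoot_of_ne _ _ _ hq, coeff_substRoot_of_ne]
    intro i hi
    exact hq i (by rw [div_left_inj' hm'] at hi; simpa using hi)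

theorem order_eq_ord {f : K0} (hf : f ≠ 0) : (f : PowerSeries ℂ).order = ord f :=
  (ENat.natCast_toNat (by simpa [PowerSeries.order_eq_top] using hf)).symm

theorem orderTop_substRoot (n : ℕ) (hn : n ≠ 0) {f : K0} (hf : f ≠ 0) :
    (substRoot n hn f : HahnSeries ℚ ℂ).orderTop = (((ord f : ℚ) / n : ℚ) : WithTop ℚ) := by
  have hn' : (0 : ℚ) < n := Nat.cast_pos.2 (Nat.pos_of_ne_zero hn)
  apply le_antisymm
  · apply HahnSeries.orderTop_le_of_coeff_ne_zero
    rw [coeff_substRoot]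
    exact PowerSeries.coeff_order (by simpa using hf)
  · rw [HahnSeries.le_orderTop_iff_forall]
    intro q hq
    by_contra h
    by_cases hi : ∃ i : ℕ, q = (i : ℚ) / n
    · obtain ⟨i, rfl⟩ := hi
      rw [coeff_substRoot] at h
      have := PowerSeries.order_le i h
      rw [order_eq_ord hf, Nat.cast_le] at this
      rw [WithTop.coe_lt_coe, div_lt_div_iff_of_pos_right hn', Nat.cast_lt] at hq
      omega
    · push Not at hi
      exact h (coeff_substRoot_of_ne _ _ _ hi)

theorem orderTop_toPuiseux {f : K0} (hf : f ≠ 0) :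
    (toPuiseux f : HahnSeries ℚ ℂ).orderTop = ((ord f : ℚ) : WithTop ℚ) := by
  simpa [toPuiseux_eq_substRoot] using orderTop_substRoot 1 one_ne_zero hf

/-! ### Formal germs versus germs of analytic functions. -/

open Filter Topology

/-- The sum of the power series `f` at the point `t`. -/
noncomputable def sumAt (f : K0) (t : ℂ) : ℂ :=
  ∑' n, PowerSeries.coeff n (f : PowerSeries ℂ) * t ^ n

theorem eventually_summable_norm (f : K0) : ∀ᶠ t in 𝓝 (0 : ℂ),
    Summable fun n : ℕ => ‖PowerSeries.coeff n (f : PowerSeries ℂ) * t ^ n‖ := by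
  obtain ⟨δ, hδ, h⟩ := f.2
  filter_upwards [Metric.ball_mem_nhds (0 : ℂ) hδ] with t ht
  exact h t (by simpa using ht)

theorem sumAt_zero (f : K0) : sumAt f 0 = PowerSeries.constantCoeff (f : PowerSeries ℂ) := by
  rw [sumAt, tsum_eq_single 0]
  · simp
  · intro n hn
    simp [hn]

/-- The germ at `0` of the function defined by a convergent power series. -/
noncomputable def toGerm : K0 →+* (𝓝 (0 : ℂ)).Germ ℂ where
  toFun f := (sumAt f : (𝓝 (0 : ℂ)).Germ ℂ)
  map_zero' := by
    refine Germ.coe_eq.2 (Eventually.of_forall fun t => ?_)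
    simp [sumAt]
  map_one' := by
    refine Germ.coe_eq.2 (Eventually.of_forall fun t => ?_)
    rw [sumAt, tsum_eq_single 0]
    · simp
    · intro n hn
      simp [PowerSeries.coeff_one, hn]
  map_add' f g := by
    refine Germ.coe_eq.2 ?_
    filter_upwards [eventually_summable_norm f, eventually_summable_norm g] with t hf hg
    simp only [sumAt]
    rw [← hf.of_norm.tsum_add hg.of_norm]
    simp [add_mul]
  map_mul' f g := by
    refine Germ.coe_eq.2 ?_
    filter_upwards [eventually_summable_norm f, eventually_summable_norm g] with t hf hg
    simp only [sumAt]
    rw [tsum_mul_tsum_eq_tsum_sum_antidiagonal_of_summable_norm hf hg]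
    refine tsum_congr fun n => ?_
    rw [MulMemClass.coe_mul, PowerSeries.coeff_mul, Finset.sum_mul]
    refine Finset.sum_congr rfl fun p hp => ?_
    rw [← Finset.HasAntidiagonal.mem_antidiagonal.mp hp, pow_add]
    ring

theorem toGerm_apply (f : K0) : toGerm f = (sumAt f : (𝓝 (0 : ℂ)).Germ ℂ) := rfl

theorem hasFPowerSeriesAt_sumAt (f : K0) : HasFPowerSeriesAt (sumAt f)
    (FormalMultilinearSeries.ofScalars ℂ fun n => PowerSeries.coeff n (f : PowerSeries ℂ)) 0 := by
  obtain ⟨r, hr, h⟩ := mem_K0_iff.1 f.2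
  set p := FormalMultilinearSeries.ofScalars ℂ fun n => PowerSeries.coeff n (f : PowerSeries ℂ)
  lift r to NNReal using hr.le
  have hrad : (r : ENNReal) ≤ p.radius := by
    apply p.le_radius_of_summable
    refine h.congr fun n => ?_
    rw [FormalMultilinearSeries.ofScalars_norm]
  have h0 : 0 < p.radius := lt_of_lt_of_le (by exact_mod_cast hr) hrad
  have := (p.hasFPowerSeriesOnBall h0).hasFPowerSeriesAt
  convert this using 1
  ext t
  simp [sumAt, p, FormalMultilinearSeries.sum, mul_comm]

theorem analyticAt_sumAt (f : K0) : AnalyticAt ℂ (sumAt f) 0 := ⟨_, hasFPowerSeriesAt_sumAt f⟩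

/-- Uniqueness of the Taylor expansion; with `exists_toGerm_eq` it moves identities and solutions
between functions and series. -/
theorem toGerm_injective : Function.Injective toGerm := by
  intro f g h
  have := (hasFPowerSeriesAt_sumAt f).eq_formalMultilinearSeries_of_eventually
    (hasFPowerSeriesAt_sumAt g) (Germ.coe_eq.1 h)
  have := FormalMultilinearSeries.ofScalars_series_injective ℂ ℂ this
  ext n
  exact congrFun this n

theorem exists_toGerm_eq {F : ℂ → ℂ} (hF : AnalyticAt ℂ F 0) :
    ∃ f : K0, toGerm f = (F : (𝓝 (0 : ℂ)).Germ ℂ) := by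
  obtain ⟨p, hp⟩ := hF
  obtain ⟨r, hr, hpr⟩ := ENNReal.lt_iff_exists_nnreal_btwn.1 hp.radius_pos
  have hs := p.summable_norm_mul_pow hpr
  refine ⟨⟨PowerSeries.mk p.coeff, mem_K0_of_summable (r := r) (by exact_mod_cast hr) ?_⟩, ?_⟩
  · simpa [FormalMultilinearSeries.norm_apply_eq_norm_coef] using hs
  · refine Germ.coe_eq.2 ?_
    have h1 := hp.eventually_hasSum
    filter_upwards [h1] with t ht
    rw [zero_add] at ht
    rw [← ht.tsum_eq, sumAt]
    refine tsum_congr fun n => ?_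
    simp [mul_comm]

/-! ### Multiplication of monic polynomials and Hensel's lemma. -/

section CoefficientVectors

variable {R : Type*} [CommRing R]

/-- The polynomial of degree less than `n` with given coefficients. -/
noncomputable def lowOf (n : ℕ) (u : Fin n → R) : R[X] := ∑ i : Fin n, C (u i) * X ^ (i : ℕ)

/-- The monic polynomial of degree `n` with given lower coefficients. -/
noncomputable def monicOf (n : ℕ) (u : Fin n → R) : R[X] := X ^ n + lowOf n u

theorem degree_lowOf_lt (n : ℕ) (u : Fin n → R) : (lowOf n u).degree < n := degree_sum_fin_lt u

theorem coeff_lowOf (n : ℕ) (u : Fin n → R) (i : Fin n) : (lowOf n u).coeff i = u i := by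
  simp [lowOf, coeff_X_pow, Fin.val_inj]

theorem lowOf_eq_zero {n : ℕ} {u : Fin n → R} (h : lowOf n u = 0) : u = 0 := by
  ext i
  rw [← coeff_lowOf n u i, h, coeff_zero, Pi.zero_apply]

theorem monic_monicOf (n : ℕ) (u : Fin n → R) : (monicOf n u).Monic :=
  monic_X_pow_add (degree_lowOf_lt n u)

theorem natDegree_monicOf [Nontrivial R] (n : ℕ) (u : Fin n → R) :
    (monicOf n u).natDegree = n := by
  rw [monicOf, natDegree_add_eq_left_of_degree_lt, natDegree_X_pow]
  rw [degree_X_pow]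
  exact degree_lowOf_lt n u

theorem monicOf_coeff {p : R[X]} (hp : p.Monic) :
    monicOf p.natDegree (fun i => p.coeff i) = p := by
  conv_rhs => rw [hp.as_sum]
  rw [monicOf, lowOf, Finset.sum_range]

theorem map_monicOf {S : Type*} [CommRing S] (φ : R →+* S) (n : ℕ) (u : Fin n → R) :
    (monicOf n u).map φ = monicOf n (fun i => φ (u i)) := by
  simp [monicOf, lowOf, Polynomial.map_sum]

theorem monicOf_add_smul (n : ℕ) (u v : Fin n → R) (s : R) :
    monicOf n (u + s • v) = monicOf n u + C s * lowOf n v := by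
  simp [monicOf, lowOf, add_mul, Finset.sum_add_distrib, Finset.mul_sum, mul_assoc, add_assoc]

/-- Injectivity of the Sylvester map: the combination has degree below `a + b`, so it vanishes; by
coprimality the first monic factor divides `lowOf a u'`, which has smaller degree. -/
theorem eq_zero_of_coeff_mul_monicOf_add [IsDomain R] {a b : ℕ} {u : Fin a → R} {v : Fin b → R}
    (hco : IsCoprime (monicOf a u) (monicOf b v)) {u' : Fin a → R} {v' : Fin b → R}
    (h : ∀ k : Fin (a + b), (lowOf a u' * monicOf b v + monicOf a u * lowOf b v').coeff k = 0) :
    u' = 0 ∧ v' = 0 := by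
  have hdeg : ∀ (n : ℕ) (w : Fin n → R), (monicOf n w).degree = n := fun n w => by
    rw [degree_eq_natDegree (monic_monicOf n w).ne_zero, natDegree_monicOf]
  have hzero : lowOf a u' * monicOf b v + monicOf a u * lowOf b v' = 0 := by
    have hlt : (lowOf a u' * monicOf b v + monicOf a u * lowOf b v').degree <
        ((a + b : ℕ) : WithBot ℕ) := by
      refine lt_of_le_of_lt (degree_add_le _ _) (max_lt ?_ ?_)
      · rw [degree_mul, hdeg, Nat.cast_add]
        exact WithBot.add_lt_add_right (by simp) (degree_lowOf_lt a u')
      · rw [degree_mul, hdeg, Nat.cast_add]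
        exact WithBot.add_lt_add_left (by simp) (degree_lowOf_lt b v')
    ext k
    by_cases hk : k < a + b
    · simpa using h ⟨k, hk⟩
    · rw [coeff_zero]
      exact coeff_eq_zero_of_degree_lt (hlt.trans_le (by exact_mod_cast not_lt.1 hk))
  have hdvd : monicOf a u ∣ lowOf a u' := by
    refine hco.dvd_of_dvd_mul_right ⟨-lowOf b v', ?_⟩
    linear_combination hzero
  have hu : lowOf a u' = 0 := by
    refine eq_zero_of_dvd_of_degree_lt hdvd ?_
    rw [hdeg]
    exact degree_lowOf_lt a u'
  refine ⟨lowOf_eq_zero hu, lowOf_eq_zero ?_⟩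
  rw [hu, zero_mul, zero_add] at hzero
  exact (mul_eq_zero.1 hzero).resolve_left (monic_monicOf a u).ne_zero

end CoefficientVectors

open scoped ContDiff

/-- The coefficients of the product of two monic polynomials, as a function of theirs. -/
noncomputable def mulCoeff (a b : ℕ) (x : (Fin a → ℂ) × (Fin b → ℂ)) : Fin (a + b) → ℂ :=
  fun k => (monicOf a x.1 * monicOf b x.2).coeff k

theorem contDiff_coeff_monicOf (n k : ℕ) :
    ContDiff ℂ ω fun u : Fin n → ℂ => (monicOf n u).coeff k := by
  simp only [monicOf, lowOf, coeff_add, finsetSum_coeff, coeff_C_mul]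
  fun_prop

theorem contDiff_mulCoeff (a b : ℕ) : ContDiff ℂ ω (mulCoeff a b) := by
  refine contDiff_pi.2 fun k => ?_
  simp only [mulCoeff, coeff_mul]
  refine ContDiff.sum fun p _ => ?_
  exact ((contDiff_coeff_monicOf a p.1).comp contDiff_fst).mul
    ((contDiff_coeff_monicOf b p.2).comp contDiff_snd)

theorem fderiv_mulCoeff_apply (a b : ℕ) (x y : (Fin a → ℂ) × (Fin b → ℂ)) (k : Fin (a + b)) :
    fderiv ℂ (mulCoeff a b) x y k =
      (lowOf a y.1 * monicOf b x.2 + monicOf a x.1 * lowOf b y.2).coeff k := by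
  have h1 := ((contDiff_mulCoeff a b).differentiable (by simp) x).hasFDerivAt.hasLineDerivAt y
  have h2 := hasDerivAt_pi.1 h1 k
  refine h2.unique ?_
  -- Along a line the product is quadratic in `s`; the derivative is its linear coefficient.
  have : (fun s : ℂ => mulCoeff a b (x + s • y) k) = fun s : ℂ =>
      (monicOf a x.1 * monicOf b x.2).coeff k +
      s * (lowOf a y.1 * monicOf b x.2 + monicOf a x.1 * lowOf b y.2).coeff k +
      s ^ 2 * (lowOf a y.1 * lowOf b y.2).coeff k := by
    ext s
    rw [mulCoeff, Prod.fst_add, Prod.snd_add, Prod.smul_fst, Prod.smul_snd, monicOf_add_smul,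
      monicOf_add_smul, ← coeff_C_mul, ← coeff_C_mul, ← coeff_add, ← coeff_add]
    congr 1
    rw [C_pow]
    ring
  rw [this]
  have h3 := (((hasDerivAt_id (0 : ℂ)).mul_const
    ((lowOf a y.1 * monicOf b x.2 + monicOf a x.1 * lowOf b y.2).coeff k)).const_add
      ((monicOf a x.1 * monicOf b x.2).coeff k)).add
      (((hasDerivAt_id (0 : ℂ)).pow 2).mul_const ((lowOf a y.1 * lowOf b y.2).coeff k))
  exact h3.congr_deriv (by simp)

/-- Coprimality makes the derivative of `mulCoeff` injective between spaces of equal dimension.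
Composing its analytic local inverse with the curve `c` gives the factors. -/
theorem exists_analyticAt_factors {a b : ℕ} {u₀ : Fin a → ℂ} {v₀ : Fin b → ℂ}
    (hco : IsCoprime (monicOf a u₀) (monicOf b v₀)) {c : ℂ → Fin (a + b) → ℂ}
    (hc : ∀ k, AnalyticAt ℂ (fun t => c t k) 0) (hc0 : c 0 = mulCoeff a b (u₀, v₀)) :
    ∃ (u : Fin a → ℂ → ℂ) (v : Fin b → ℂ → ℂ), (∀ i, AnalyticAt ℂ (u i) 0) ∧
      (∀ i, AnalyticAt ℂ (v i) 0) ∧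
      ∀ᶠ t in 𝓝 0, mulCoeff a b (fun i => u i t, fun i => v i t) = c t := by
  set D := fderiv ℂ (mulCoeff a b) (u₀, v₀)
  have hinj : Function.Injective (D : (Fin a → ℂ) × (Fin b → ℂ) →ₗ[ℂ] Fin (a + b) → ℂ) := by
    rw [← LinearMap.ker_eq_bot, LinearMap.ker_eq_bot']
    intro y hy
    have := eq_zero_of_coeff_mul_monicOf_add hco (u' := y.1) (v' := y.2) fun k => by
      rw [← fderiv_mulCoeff_apply a b (u₀, v₀) y k]
      exact congrFun hy k
    exact Prod.ext this.1 this.2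
  let e := (LinearEquiv.ofInjectiveOfFinrankEq
    (D : (Fin a → ℂ) × (Fin b → ℂ) →ₗ[ℂ] Fin (a + b) → ℂ) hinj
      (by simp)).toContinuousLinearEquiv
  have he : (e : (Fin a → ℂ) × (Fin b → ℂ) →L[ℂ] Fin (a + b) → ℂ) = D := by
    ext y <;> rfl
  have hcd : ContDiffAt ℂ ω (mulCoeff a b) (u₀, v₀) := (contDiff_mulCoeff a b).contDiffAt
  have hfd : HasFDerivAt (mulCoeff a b)
      (e : (Fin a → ℂ) × (Fin b → ℂ) →L[ℂ] Fin (a + b) → ℂ) (u₀, v₀) := by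
    rw [he]
    exact (hcd.differentiableAt (by simp)).hasFDerivAt
  have hcA : ContDiffAt ℂ ω c 0 := contDiffAt_pi.2 fun k => (hc k).contDiffAt
  have hG : ContDiffAt ℂ ω (fun t => hcd.localInverse hfd (by simp) (c t)) 0 := by
    have := hcd.to_localInverse hfd (by simp)
    rw [← hc0] at this
    exact this.comp 0 hcA
  refine ⟨fun i t => (hcd.localInverse hfd (by simp) (c t)).1 i,
    fun i t => (hcd.localInverse hfd (by simp) (c t)).2 i, fun i => ?_, fun i => ?_, ?_⟩
  · exact (contDiffAt_pi.1 hG.fst i).analyticAt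
  · exact (contDiffAt_pi.1 hG.snd i).analyticAt
  · have h1 := (hcd.hasStrictFDerivAt' hfd (by simp)).eventually_right_inverse
    rw [← hc0] at h1
    exact hcA.continuousAt.eventually h1

/-- Hensel's lemma for germs of analytic functions: a factorization into coprime monic factors at
`t = 0` lifts. -/
theorem exists_factors_of_isCoprime {f : K0[X]} (hf : f.Monic) {g₀ h₀ : ℂ[X]} (hg₀ : g₀.Monic)
    (hh₀ : h₀.Monic) (hco : IsCoprime g₀ h₀)
    (hfac : f.map ((PowerSeries.constantCoeff (R := ℂ)).comp K0.val.toRingHom) = g₀ * h₀) :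
    ∃ g h : K0[X], g.Monic ∧ h.Monic ∧ g.natDegree = g₀.natDegree ∧
      h.natDegree = h₀.natDegree ∧ f = g * h := by
  have hdeg : f.natDegree = g₀.natDegree + h₀.natDegree := by
    rw [← hg₀.natDegree_mul hh₀, ← hfac, hf.natDegree_map]
  obtain ⟨u, v, hu, hv, huv⟩ := exists_analyticAt_factors
    (u₀ := fun i => g₀.coeff i) (v₀ := fun i => h₀.coeff i)
    (c := fun t k => sumAt (f.coeff k) t) (by rwa [monicOf_coeff hg₀, monicOf_coeff hh₀])
    (fun k => analyticAt_sumAt _) (by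
      ext k
      rw [mulCoeff, monicOf_coeff hg₀, monicOf_coeff hh₀, ← hfac, coeff_map, sumAt_zero]
      rfl)
  choose U hU using fun i => exists_toGerm_eq (hu i)
  choose V hV using fun i => exists_toGerm_eq (hv i)
  refine ⟨monicOf _ U, monicOf _ V, monic_monicOf _ _, monic_monicOf _ _, natDegree_monicOf _ _,
    natDegree_monicOf _ _, ?_⟩
  have hmon := (monic_monicOf _ U).mul (monic_monicOf _ V)
  have hnd : (monicOf _ U * monicOf _ V).natDegree = g₀.natDegree + h₀.natDegree := by
    rw [(monic_monicOf _ U).natDegree_mul (monic_monicOf _ V), natDegree_monicOf,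
      natDegree_monicOf]
  have hlow : ∀ k < g₀.natDegree + h₀.natDegree,
      f.coeff k = (monicOf _ U * monicOf _ V).coeff k := by
    intro k hk
    apply toGerm_injective
    -- The identity is checked in the ring of germs, where the product is the image of one over the
    -- ring of functions and can be evaluated at each `t`.
    have h1 : (monicOf _ U * monicOf _ V).map toGerm =
        (monicOf _ u * monicOf _ v).map (Germ.coeRingHom (𝓝 (0 : ℂ))) := by
      rw [Polynomial.map_mul, Polynomial.map_mul, map_monicOf, map_monicOf, map_monicOf,
        map_monicOf]
      simp only [hU, hV]
      rfl
    rw [← coeff_map, ← coeff_map, h1, coeff_map, coeff_map, toGerm_apply]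
    refine Germ.coe_eq.2 ?_
    filter_upwards [huv] with t ht
    have h2 := congrFun ht ⟨k, hk⟩
    rw [← h2, mulCoeff]
    have h3 : (monicOf _ u * monicOf _ v).map (Pi.evalRingHom (fun _ : ℂ => ℂ) t) =
        monicOf _ (fun i => u i t) * monicOf _ (fun i => v i t) := by
      rw [Polynomial.map_mul, map_monicOf, map_monicOf]
      rfl
    rw [← h3, coeff_map]
    rfl
  ext1 k
  rcases lt_trichotomy k (g₀.natDegree + h₀.natDegree) with hk | hk | hk
  · exact hlow k hk
  · rw [hk]
    conv_lhs => rw [← hdeg, hf.coeff_natDegree]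
    rw [← hnd, hmon.coeff_natDegree]
  · rw [coeff_eq_zero_of_natDegree_lt (hdeg ▸ hk), coeff_eq_zero_of_natDegree_lt (hnd ▸ hk)]

/-! ### The Newton–Puiseux theorem. -/

theorem splits_scaleRoots {R : Type*} [CommRing R] [NoZeroDivisors R] {p : R[X]} (hp : p.Splits)
    (s : R) : (p.scaleRoots s).Splits := by
  refine Submonoid.closure_induction ?_ ?_ ?_ hp
  · rintro _ (⟨a, rfl⟩ | ⟨a, rfl⟩)
    · rw [scaleRoots_C]
      exact Splits.C a
    · rw [X_add_C_scaleRoots]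
      exact Splits.X_add_C _
  · rw [one_scaleRoots]
    exact Splits.one
  · intro x y _ _ hx hy
    rw [mul_scaleRoots_of_noZeroDivisors]
    exact hx.mul hy

theorem coeff_taylor_natDegree_sub_one {R : Type*} [CommRing R] {p : R[X]} (hp : p.Monic)
    (h : 0 < p.natDegree) (r : R) : (taylor r p).coeff (p.natDegree - 1) =
      p.coeff (p.natDegree - 1) + p.natDegree * r := by
  obtain ⟨m, hm⟩ : ∃ m, p.natDegree = m + 1 := ⟨p.natDegree - 1, by omega⟩
  have hlc : p.coeff (m + 1) = 1 := hm ▸ hp.coeff_natDegree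
  have hd : (hasseDeriv m p).natDegree < 2 := by
    have := natDegree_hasseDeriv_le p m
    omega
  rw [hm, Nat.add_sub_cancel, taylor_coeff, eval_eq_sum_range' hd, Finset.sum_range_succ,
    Finset.sum_range_one]
  simp [hasseDeriv_coeff, add_comm 1 m, hlc]

/-- A monic complex polynomial of positive degree is a product of coprime monic polynomials of
positive degree, unless it has a single root. -/
theorem exists_coprime_factors_or_eq_pow {p : ℂ[X]} (hp : p.Monic) (h : 0 < p.natDegree) :
    (∃ a : ℂ, p = (X - C a) ^ p.natDegree) ∨ ∃ g h : ℂ[X], g.Monic ∧ h.Monic ∧ IsCoprime g h ∧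
      0 < g.natDegree ∧ 0 < h.natDegree ∧ p = g * h := by
  obtain ⟨a, ha⟩ := IsAlgClosed.exists_root p (by
    rw [degree_eq_natDegree hp.ne_zero]
    exact_mod_cast h.ne')
  obtain ⟨q, hq, hnd⟩ := exists_eq_pow_rootMultiplicity_mul_and_not_dvd p hp.ne_zero a
  have hpos : 0 < p.rootMultiplicity a := (rootMultiplicity_pos hp.ne_zero).2 ha
  have hpow : ((X - C a) ^ p.rootMultiplicity a).Monic := (monic_X_sub_C a).pow _
  have hqm : q.Monic := hpow.of_mul_monic_left (hq ▸ hp)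
  by_cases hd : q.natDegree = 0
  · left
    rw [hqm.natDegree_eq_zero] at hd
    rw [hd, mul_one] at hq
    refine ⟨a, ?_⟩
    conv_rhs => rw [hq, natDegree_pow, natDegree_X_sub_C, mul_one]
    exact hq
  · right
    refine ⟨_, q, hpow, hqm, ?_, ?_, Nat.pos_of_ne_zero hd, hq⟩
    · exact (((irreducible_X_sub_C a).coprime_iff_not_dvd).2 hnd).pow_left
    · rwa [natDegree_pow, natDegree_X_sub_C, mul_one]

/-- After a ramification and a scaling of the variable, a monic polynomial without subleading term,
other than a power of the variable, acquires a reduction at `t = 0` with several roots. -/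
theorem exists_scaleRoots_eq {Q : K0[X]} (hQ : Q.Monic)
    (hnext : Q.coeff (Q.natDegree - 1) = 0) (hne : Q ≠ X ^ Q.natDegree) :
    ∃ (n : ℕ) (hn : n ≠ 0) (p : ℕ) (R : K0[X]), R.Monic ∧ R.natDegree = Q.natDegree ∧
      Q.map (expand n hn) = R.scaleRoots (coord ^ p) ∧ R.coeff (Q.natDegree - 1) = 0 ∧
      ∃ j < Q.natDegree, PowerSeries.constantCoeff (R.coeff j : PowerSeries ℂ) ≠ 0 := by
  classical
  set m := Q.natDegree with hm
  set S := (Finset.range m).filter fun j => Q.coeff j ≠ 0 with hS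
  have hSne : S.Nonempty := by
    by_contra h
    rw [Finset.not_nonempty_iff_eq_empty, Finset.filter_eq_empty_iff] at h
    apply hne
    conv_lhs => rw [hQ.as_sum]
    rw [Finset.sum_eq_zero fun i hi => by rw [not_not.1 (h hi), C_0, zero_mul], add_zero]
  -- The minimum of `ord q_j / (m - j)` is the smallest order a root can have. Ramifying by `m - k`
  -- makes it the integer `p`, so every coefficient becomes divisible by `t ^ (p * (m - j))`,
  -- exactly so at `j = k`.
  obtain ⟨k, hk, hmin⟩ := S.exists_min_image
    (fun j => (ord (Q.coeff j) : ℚ) / ((m - j : ℕ) : ℚ)) hSne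
  obtain ⟨hkm, hk0⟩ := Finset.mem_filter.1 hk
  rw [Finset.mem_range] at hkm
  have hn : m - k ≠ 0 := by omega
  set p := ord (Q.coeff k) with hp
  have key : ∀ j : Fin m, ∃ b : K0,
      expand (m - k) hn (Q.coeff j) = coord ^ (p * (m - j)) * b := by
    intro j
    apply exists_eq_coord_pow_mul
    by_cases hj : Q.coeff j = 0
    · simp [hj]
    have h1 := hmin j (Finset.mem_filter.2 ⟨Finset.mem_range.2 j.2, hj⟩)
    have hjm := j.2
    rw [div_le_div_iff₀ (by exact_mod_cast Nat.pos_of_ne_zero hn)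
      (by exact_mod_cast Nat.sub_pos_of_lt j.2)] at h1
    rw [coe_expand, PowerSeries.order_expand, order_eq_ord hj, nsmul_eq_mul,
      mul_comm ((m - k : ℕ) : ℕ∞)]
    exact_mod_cast h1
  choose b hb using key
  have hcoeff : ∀ j : Fin m, (monicOf m b).coeff j = b j := fun j => by
    rw [monicOf, coeff_add, coeff_lowOf, coeff_X_pow, if_neg j.2.ne, zero_add]
  have hndR : (monicOf m b).natDegree = m := natDegree_monicOf _ _
  refine ⟨m - k, hn, p, monicOf m b, monic_monicOf _ _, hndR, ?_, ?_, k, hkm, ?_⟩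
  · ext1 j
    rw [coeff_map, coeff_scaleRoots, hndR]
    rcases lt_trichotomy j m with hj | rfl | hj
    · rw [hb ⟨j, hj⟩, hcoeff ⟨j, hj⟩, ← pow_mul, mul_comm]
    · have h1 : Q.coeff m = 1 := hQ.coeff_natDegree
      have h2 : (monicOf m b).coeff m = 1 := by
        have := (monic_monicOf m b).coeff_natDegree
        rwa [hndR] at this
      simp [h1, h2]
    · rw [coeff_eq_zero_of_natDegree_lt hj, coeff_eq_zero_of_natDegree_lt (hndR.trans_lt hj)]
      simp
  · have h1 := hb ⟨m - 1, by omega⟩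
    rw [hcoeff ⟨m - 1, by omega⟩]
    simp only [hnext, map_zero] at h1
    refine (mul_eq_zero.1 h1.symm).resolve_left (pow_ne_zero _ fun h => ?_)
    exact PowerSeries.X_ne_zero (congrArg (Subtype.val (p := (· ∈ K0))) h)
  · have h1 := congrArg (fun f : K0 => PowerSeries.coeff ((m - k) * p) (f : PowerSeries ℂ))
      (hb ⟨k, hkm⟩)
    simp only [coe_expand, PowerSeries.coeff_expand_mul, MulMemClass.coe_mul,
      SubmonoidClass.coe_pow, coe_coord, PowerSeries.coeff_X_pow_mul'] at h1
    rw [if_pos (by rw [mul_comm]), mul_comm, Nat.sub_self,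
      PowerSeries.coeff_zero_eq_constantCoeff] at h1
    rw [hcoeff ⟨k, hkm⟩]
    change PowerSeries.constantCoeff (b ⟨k, hkm⟩ : PowerSeries ℂ) ≠ 0
    rw [← h1]
    exact PowerSeries.coeff_order (by simpa using hk0)

theorem splits_expand_mul {Q : K0[X]} {n : ℕ} {hn : n ≠ 0} (h : (Q.map (expand n hn)).Splits)
    (k : ℕ) (hk : k ≠ 0) : (Q.map (expand (k * n) (mul_ne_zero hk hn))).Splits := by
  have := h.map (expand k hk)
  rwa [Polynomial.map_map, show (expand k hk).comp (expand n hn) = expand (k * n) _ from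
    RingHom.ext fun f => expand_expand k n hk hn f] at this

theorem exists_splits_expand_mul {Q₁ Q₂ : K0[X]}
    (h₁ : ∃ (n : ℕ) (hn : n ≠ 0), (Q₁.map (expand n hn)).Splits)
    (h₂ : ∃ (n : ℕ) (hn : n ≠ 0), (Q₂.map (expand n hn)).Splits) :
    ∃ (n : ℕ) (hn : n ≠ 0), ((Q₁ * Q₂).map (expand n hn)).Splits := by
  obtain ⟨n, hn, h₁⟩ := h₁
  obtain ⟨k, hk, h₂⟩ := h₂
  refine ⟨k * n, mul_ne_zero hk hn, ?_⟩
  rw [Polynomial.map_mul]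
  refine (splits_expand_mul h₁ k hk).mul ?_
  have := splits_expand_mul h₂ n hn
  simpa only [mul_comm n k] using this

/-- The Newton–Puiseux theorem for germs of analytic functions: every monic polynomial splits after
a substitution of `t ^ n` for `t`. -/
theorem exists_splits_expand {Q : K0[X]} (hQ : Q.Monic) :
    ∃ (n : ℕ) (hn : n ≠ 0), (Q.map (expand n hn)).Splits := by
  induction hm : Q.natDegree using Nat.strong_induction_on generalizing Q with
  | _ m ih =>
  by_cases hm1 : m ≤ 1
  · exact ⟨1, one_ne_zero, Splits.of_natDegree_le_one_of_monic
      (by rw [hQ.natDegree_map]; omega) (hQ.map _)⟩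
  have hm0 : (m : ℂ) ≠ 0 := Nat.cast_ne_zero.2 (by omega)
  -- Tschirnhaus shift: translating by the mean of the roots removes the subleading coefficient.
  set c : K0 := -(algebraMap ℂ K0 (m : ℂ)⁻¹ * Q.coeff (m - 1)) with hc
  have hT : (taylor c Q).Monic := (leadingCoeff_taylor (f := Q) (r := c)).trans hQ
  have hTd : (taylor c Q).natDegree = m := by rw [natDegree_taylor, hm]
  have hTn : (taylor c Q).coeff ((taylor c Q).natDegree - 1) = 0 := by
    rw [natDegree_taylor, coeff_taylor_natDegree_sub_one hQ (by omega), hm]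
    have hinv : (m : K0) * algebraMap ℂ K0 (m : ℂ)⁻¹ = 1 := by
      rw [← map_natCast (algebraMap ℂ K0) m, ← map_mul, mul_inv_cancel₀ hm0, map_one]
    linear_combination (-Q.coeff (m - 1)) * hinv
  suffices h : ∃ (n : ℕ) (hn : n ≠ 0), ((taylor c Q).map (expand n hn)).Splits by
    obtain ⟨n, hn, h⟩ := h
    refine ⟨n, hn, ?_⟩
    have h1 := h.taylor (-expand n hn c)
    rwa [map_taylor, taylor_taylor, add_comm, add_neg_cancel (expand n hn c), taylor_zero] at h1
  by_cases hX : taylor c Q = X ^ (taylor c Q).natDegree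
  · refine ⟨1, one_ne_zero, ?_⟩
    rw [hX, Polynomial.map_pow, map_X]
    exact Splits.X_pow _
  obtain ⟨n, hn, p, R, hR, hRd, hscale, hRn, j, hj, hRj⟩ := exists_scaleRoots_eq hT hTn hX
  rw [hTd] at hRd hRn hj
  set φ := (PowerSeries.constantCoeff (R := ℂ)).comp K0.val.toRingHom with hφ
  have hR0d : (R.map φ).natDegree = m := by rw [hR.natDegree_map, hRd]
  obtain ⟨k, hk, hsplit⟩ : ∃ (k : ℕ) (hk : k ≠ 0), (R.map (expand k hk)).Splits := by
    rcases exists_coprime_factors_or_eq_pow (hR.map φ) (by omega) with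
      ⟨a, ha⟩ | ⟨g₀, h₀, hg₀, hh₀, hco, hgd, hhd, hfac⟩
    -- A reduction `(X - C a) ^ m` without subleading term has `a = 0`, against the nonzero
    -- coefficient at `j < m`.
    · exfalso
      rw [hR0d] at ha
      have h1 : (R.map φ).nextCoeff = 0 := by
        rw [nextCoeff_of_natDegree_pos (by omega), hR0d, coeff_map, hRn, map_zero]
      rw [ha, (monic_X_sub_C a).nextCoeff_pow, nextCoeff_X_sub_C, nsmul_eq_mul,
        mul_eq_zero, neg_eq_zero] at h1
      rw [h1.resolve_left hm0, C_0, sub_zero] at ha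
      apply hRj
      change φ (R.coeff j) = 0
      rw [← coeff_map, ha, coeff_X_pow, if_neg hj.ne]
    · obtain ⟨g, h, hg, hh, hgd', hhd', rfl⟩ := exists_factors_of_isCoprime hR hg₀ hh₀ hco hfac
      have hadd : m = g.natDegree + h.natDegree := by rw [← hRd, hg.natDegree_mul hh]
      exact exists_splits_expand_mul (ih _ (by omega) hg rfl) (ih _ (by omega) hh rfl)
  refine ⟨k * n, mul_ne_zero hk hn, ?_⟩
  have h1 := splits_scaleRoots hsplit (expand k hk (coord ^ p))
  rwa [← map_scaleRoots _ _ _ (by rw [hR.leadingCoeff, map_one]; exact one_ne_zero), ← hscale,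
    Polynomial.map_map, show (expand k hk).comp (expand n hn) = expand (k * n) _ from
    RingHom.ext fun f => expand_expand k n hk hn f] at h1

/-! ### Lower vertices and edges of the Newton polygon. -/

theorem mem_points {Q : K0[X]} {i : ℕ} (hi : i ∈ Q.support) :
    ((i : ℝ), (ord (Q.coeff i) : ℝ)) ∈ points Q :=
  ⟨i, le_natDegree_of_mem_supp i hi, mem_support_iff.1 hi, rfl⟩

theorem mem_abscissae {Q : K0[X]} {i : ℕ} : i ∈ abscissae Q ↔
    i ∈ Q.support ∧ ((i : ℝ), (ord (Q.coeff i) : ℝ)) ∈ lowerVertices Q := by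
  simp only [abscissae, Finset.mem_filter, Finset.mem_range, mem_support_iff]
  refine ⟨fun h => h.2, fun h => ⟨?_, h⟩⟩
  exact Nat.lt_succ_of_le (le_natDegree_of_ne_zero h.1)

/-- Minimizing first a linear functional and then a multiple of the abscissa over the points of the
Newton polygon yields a lower vertex. -/
theorem mem_abscissae_of_lex_min {Q : K0[X]} {i : ℕ} (hi : i ∈ Q.support) (s ε : ℝ) (hε : ε ≠ 0)
    (h : ∀ j ∈ Q.support,
      (ord (Q.coeff i) : ℝ) - s * i < ord (Q.coeff j) - s * j ∨
      ((ord (Q.coeff j) : ℝ) - s * j = ord (Q.coeff i) - s * i ∧ ε * i ≤ ε * j)) :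
    i ∈ abscissae Q := by
  set c := (ord (Q.coeff i) : ℝ) - s * i with hc
  -- An open half-plane together with a closed ray of its boundary line, convex and with the
  -- candidate vertex as the end of the ray. The sign of `ε` selects the left or right end of a
  -- face.
  set D : Set (ℝ × ℝ) := {p | c < p.2 - s * p.1 ∨ (p.2 - s * p.1 = c ∧ ε * i ≤ ε * p.1)} with hD
  have hconv : Convex ℝ D := by
    rw [convex_iff_forall_pos]
    intro p hp q hq a b ha hb hab
    have e1 : (a • p + b • q).2 - s * (a • p + b • q).1 =
        a * (p.2 - s * p.1) + b * (q.2 - s * q.1) := by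
      simp only [Prod.fst_add, Prod.snd_add, Prod.smul_fst, Prod.smul_snd, smul_eq_mul]
      ring
    have e2 : ε * (a • p + b • q).1 = a * (ε * p.1) + b * (ε * q.1) := by
      simp only [Prod.fst_add, Prod.smul_fst, smul_eq_mul]
      ring
    have e3 : c = a * c + b * c := by rw [← add_mul, hab, one_mul]
    have e4 : ε * i = a * (ε * i) + b * (ε * i) := by rw [← add_mul, hab, one_mul]
    simp only [hD, Set.mem_ofPred_eq, e1, e2] at hp hq ⊢
    rcases hp with hp | ⟨hp, hp'⟩ <;> rcases hq with hq | ⟨hq, hq'⟩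
    · left
      linarith [mul_lt_mul_of_pos_left hp ha, mul_lt_mul_of_pos_left hq hb]
    · left
      rw [hq]
      linarith [mul_lt_mul_of_pos_left hp ha]
    · left
      rw [hp]
      linarith [mul_lt_mul_of_pos_left hq hb]
    · right
      rw [hp, hq]
      exact ⟨e3.symm, by
        linarith [mul_le_mul_of_nonneg_left hp' ha.le, mul_le_mul_of_nonneg_left hq' hb.le]⟩
  have hsub : newtonPolygon Q ⊆ D := by
    refine convexHull_min ?_ hconv
    rintro _ ⟨j, -, hj, rfl⟩
    rcases h j (mem_support_iff.2 hj) with h1 | h1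
    · exact Or.inl h1
    · exact Or.inr h1
  have hle : ∀ p ∈ newtonPolygon Q, c ≤ p.2 - s * p.1 := fun p hp => by
    rcases hsub hp with h1 | h1
    · exact h1.le
    · exact h1.1.ge
  refine mem_abscissae.2 ⟨hi, ?_, fun y hy => ?_⟩
  · rw [mem_extremePoints]
    refine ⟨subset_convexHull ℝ _ (mem_points hi), ?_⟩
    intro p hp q hq hpq
    obtain ⟨a, b, ha, hb, hab, heq⟩ := hpq
    have h1 : a * p.1 + b * q.1 = i := congrArg Prod.fst heq
    have h2 : a * p.2 + b * q.2 = ord (Q.coeff i) := congrArg Prod.snd heq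
    have hb' : b = 1 - a := by linarith
    have e1 : a * (p.2 - s * p.1 - c) + b * (q.2 - s * q.1 - c) = 0 := by
      rw [hc]
      linear_combination h2 - s * h1 + (s * i - ord (Q.coeff i)) * hab
    have hp1 := hle p hp
    have hq1 := hle q hq
    have hp2 : p.2 - s * p.1 = c := by
      have := mul_nonneg ha.le (sub_nonneg.2 hp1)
      have := mul_nonneg hb.le (sub_nonneg.2 hq1)
      have : a * (p.2 - s * p.1 - c) = 0 := by linarith
      linarith [(mul_eq_zero.1 this).resolve_left ha.ne']
    have hq2 : q.2 - s * q.1 = c := by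
      have := mul_nonneg ha.le (sub_nonneg.2 hp1)
      have := mul_nonneg hb.le (sub_nonneg.2 hq1)
      have : b * (q.2 - s * q.1 - c) = 0 := by linarith
      linarith [(mul_eq_zero.1 this).resolve_left hb.ne']
    have hp3 : ε * i ≤ ε * p.1 := by
      rcases hsub hp with h3 | h3
      · exact absurd hp2 h3.ne'
      · exact h3.2
    have hq3 : ε * i ≤ ε * q.1 := by
      rcases hsub hq with h3 | h3
      · exact absurd hq2 h3.ne'
      · exact h3.2
    have e2 : a * (ε * p.1 - ε * i) + b * (ε * q.1 - ε * i) = 0 := by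
      linear_combination ε * h1 - ε * i * hab
    have hpi : p.1 = i := by
      have := mul_nonneg ha.le (sub_nonneg.2 hp3)
      have := mul_nonneg hb.le (sub_nonneg.2 hq3)
      have : a * (ε * p.1 - ε * i) = 0 := by linarith
      exact mul_left_cancel₀ hε (by linarith [(mul_eq_zero.1 this).resolve_left ha.ne'])
    have hqi : q.1 = i := by
      have := mul_nonneg ha.le (sub_nonneg.2 hp3)
      have := mul_nonneg hb.le (sub_nonneg.2 hq3)
      have : b * (ε * q.1 - ε * i) = 0 := by linarith
      exact mul_left_cancel₀ hε (by linarith [(mul_eq_zero.1 this).resolve_left hb.ne'])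
    constructor
    · refine Prod.ext hpi ?_
      rw [hpi] at hp2
      simp only
      linarith
    · refine Prod.ext hqi ?_
      rw [hqi] at hq2
      simp only
      linarith
  · have := hle _ hy
    simp only at this ⊢
    linarith

/-- A lower vertex lies strictly below the chords of the Newton polygon. -/
theorem lt_chord_of_mem_abscissae {Q : K0[X]} {i j k : ℕ} (hi : i ∈ abscissae Q)
    (hj : j ∈ Q.support) (hk : k ∈ Q.support) (hji : j < i) (hik : i < k) :
    (ord (Q.coeff i) : ℝ) * (k - j) < ord (Q.coeff j) * (k - i) + ord (Q.coeff k) * (i - j) := by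
  obtain ⟨-, hext, hlow⟩ := mem_abscissae.1 hi
  have h1 : (0 : ℝ) < i - j := sub_pos.2 (Nat.cast_lt.2 hji)
  have h2 : (0 : ℝ) < k - i := sub_pos.2 (Nat.cast_lt.2 hik)
  have h3 : (0 : ℝ) < k - j := by linarith
  set y : ℝ := (ord (Q.coeff j) * (k - i) + ord (Q.coeff k) * (i - j)) / (k - j) with hy
  have hseg : ((i : ℝ), y) ∈ openSegment ℝ ((j : ℝ), (ord (Q.coeff j) : ℝ))
      ((k : ℝ), (ord (Q.coeff k) : ℝ)) := by
    refine ⟨(k - i) / (k - j), (i - j) / (k - j), div_pos h2 h3, div_pos h1 h3, ?_, ?_⟩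
    · field_simp
      ring
    · refine Prod.ext ?_ ?_
      · simp only [Prod.fst_add, Prod.smul_fst, smul_eq_mul]
        field_simp
        ring
      · simp only [Prod.snd_add, Prod.smul_snd, smul_eq_mul, hy]
        field_simp
  have hjm := subset_convexHull ℝ _ (mem_points hj)
  have hkm := subset_convexHull ℝ _ (mem_points hk)
  have hle := hlow y ((convex_convexHull ℝ _).openSegment_subset hjm hkm hseg)
  simp only at hle
  rw [← lt_div_iff₀ h3, ← hy]
  -- Equality would put an extreme point inside an open segment of the polygon.
  refine lt_of_le_of_ne hle fun heq => ?_
  rw [← heq] at hseg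
  have := ((mem_extremePoints.1 hext).2 _ hjm _ hkm hseg).1
  have := congrArg Prod.fst this
  simp only [Nat.cast_inj] at this
  omega

/-- The line through two consecutive lower vertices supports the Newton polygon, and touches it only
between the two. -/
theorem support_line_of_consecutive {Q : K0[X]} {a b : ℕ} (ha : a ∈ abscissae Q)
    (hb : b ∈ abscissae Q) (hab : a < b) (hcons : ∀ i ∈ abscissae Q, i ≤ a ∨ b ≤ i) {s : ℝ}
    (hs : (ord (Q.coeff b) : ℝ) - s * b = ord (Q.coeff a) - s * a) :
    ∀ j ∈ Q.support, (ord (Q.coeff a) : ℝ) - s * a ≤ ord (Q.coeff j) - s * j ∧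
      ((ord (Q.coeff j) : ℝ) - s * j = ord (Q.coeff a) - s * a → a ≤ j ∧ j ≤ b) := by
  classical
  have haS := (mem_abscissae.1 ha).1
  have hbS := (mem_abscissae.1 hb).1
  set f : ℕ → ℝ := fun i => (ord (Q.coeff i) : ℝ) - s * i with hf
  set M := Q.support.filter fun i => ∀ j ∈ Q.support, f i ≤ f j with hM
  have hMne : M.Nonempty := by
    obtain ⟨i, hi, him⟩ := Q.support.exists_min_image f ⟨a, haS⟩
    exact ⟨i, Finset.mem_filter.2 ⟨hi, him⟩⟩
  have hMmem : ∀ i ∈ M, i ∈ Q.support ∧ ∀ j ∈ Q.support, f i ≤ f j := fun i hi =>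
    Finset.mem_filter.1 hi
  have hMof : ∀ i ∈ M, ∀ j ∈ Q.support, f j = f i → j ∈ M := fun i hi j hj h =>
    Finset.mem_filter.2 ⟨hj, fun k hk => h ▸ (hMmem i hi).2 k hk⟩
  -- The ends `l` and `r` of the face minimizing `f` are lower vertices, so `hcons` restricts their
  -- position.
  set l := M.min' hMne with hl
  set r := M.max' hMne with hr
  have hlM : l ∈ M := M.min'_mem hMne
  have hrM : r ∈ M := M.max'_mem hMne
  have hlA : l ∈ abscissae Q := by
    refine mem_abscissae_of_lex_min (hMmem l hlM).1 s 1 one_ne_zero fun j hj => ?_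
    rcases ((hMmem l hlM).2 j hj).lt_or_eq with h | h
    · exact Or.inl h
    · refine Or.inr ⟨h.symm, ?_⟩
      rw [one_mul, one_mul, Nat.cast_le]
      exact M.min'_le _ (hMof l hlM j hj h.symm)
  have hrA : r ∈ abscissae Q := by
    refine mem_abscissae_of_lex_min (hMmem r hrM).1 s (-1) (by norm_num) fun j hj => ?_
    rcases ((hMmem r hrM).2 j hj).lt_or_eq with h | h
    · exact Or.inl h
    · refine Or.inr ⟨h.symm, ?_⟩
      rw [neg_one_mul, neg_one_mul, neg_le_neg_iff, Nat.cast_le]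
      exact M.le_max' _ (hMof r hrM j hj h.symm)
  have hfl : ∀ j ∈ M, f j = f l := fun j hj =>
    le_antisymm ((hMmem j hj).2 l (hMmem l hlM).1) ((hMmem l hlM).2 j (hMmem j hj).1)
  have hfb : f b = f a := hs
  have habR : (a : ℝ) < b := Nat.cast_lt.2 hab
  -- If the line through `a` and `b` were not supporting, `l` would lie strictly below it, left of
  -- `a` or right of `b`; then `a` or `b` would lie above the chord from `l` to the other one.
  have hmin : f a = f l := by
    by_contra hne
    have hlt : f l < f a := lt_of_le_of_ne ((hMmem l hlM).2 a haS) (Ne.symm hne)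
    rcases hcons l hlA with h | h
    · have hla : l < a := lt_of_le_of_ne h fun h' => hne (by rw [h'])
      have h1 := lt_chord_of_mem_abscissae ha (hMmem l hlM).1 hbS hla hab
      have h2 : (0 : ℝ) < (b - a) * (f a - f l) := mul_pos (sub_pos.2 habR) (sub_pos.2 hlt)
      simp only [hf] at h2 hfb
      nlinarith
    · have hbl : b < l := lt_of_le_of_ne h fun h' => hne (by rw [← h', hfb])
      have h1 := lt_chord_of_mem_abscissae hb haS (hMmem l hlM).1 hab hbl
      have h2 : (0 : ℝ) < (b - a) * (f a - f l) := mul_pos (sub_pos.2 habR) (sub_pos.2 hlt)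
      simp only [hf] at h2 hfb
      nlinarith
  have haM : a ∈ M := hMof l hlM a haS hmin
  have hbM : b ∈ M := hMof l hlM b hbS (hfb.trans hmin)
  have hla : a ≤ l := by
    by_contra hlt
    have h1 := lt_chord_of_mem_abscissae ha (hMmem l hlM).1 hbS (not_le.1 hlt) hab
    simp only [hf] at hfb hmin
    nlinarith
  have hrb : r ≤ b := by
    by_contra hlt
    have h1 := lt_chord_of_mem_abscissae hb haS (hMmem r hrM).1 hab (not_le.1 hlt)
    have h3 : f r = f a := (hfl r hrM).trans hmin.symm
    simp only [hf] at hfb h3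
    nlinarith
  intro j hj
  refine ⟨(hMmem a haM).2 j hj, fun h => ?_⟩
  have hjM := hMof a haM j hj h
  exact ⟨hla.trans (M.min'_le _ hjM), (M.le_max' _ hjM).trans hrb⟩

theorem zero_mem_abscissae {Q : K0[X]} (h0 : Q.coeff 0 ≠ 0) : 0 ∈ abscissae Q := by
  -- A slope so steep that any `j ≥ 1` costs more than `ord q_0`.
  refine mem_abscissae_of_lex_min (mem_support_iff.2 h0) (-(ord (Q.coeff 0) + 1)) 1 one_ne_zero
    fun j hj => ?_
  rcases Nat.eq_zero_or_pos j with rfl | h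
  · simp
  · left
    have : (1 : ℝ) ≤ j := by exact_mod_cast h
    have h1 : (0 : ℝ) ≤ ord (Q.coeff 0) := Nat.cast_nonneg _
    have h2 : (0 : ℝ) ≤ ord (Q.coeff j) := Nat.cast_nonneg _
    push_cast
    nlinarith

theorem ord_one : ord 1 = 0 := by simp [ord]

theorem natDegree_mem_abscissae {Q : K0[X]} (hQ : Q.Monic) : Q.natDegree ∈ abscissae Q := by
  -- Any positive slope would do, since all orders are nonnegative and the leading one is `0`.
  refine mem_abscissae_of_lex_min (natDegree_mem_support_of_nonzero hQ.ne_zero) 1 1 one_ne_zero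
    fun j hj => ?_
  rw [hQ.coeff_natDegree, ord_one]
  rcases (le_natDegree_of_mem_supp j hj).lt_or_eq with h | rfl
  · left
    have : (j : ℝ) < Q.natDegree := by exact_mod_cast h
    have h2 : (0 : ℝ) ≤ ord (Q.coeff j) := Nat.cast_nonneg _
    push_cast
    linarith
  · right
    rw [hQ.coeff_natDegree, ord_one]
    simp

theorem card_abscissae_eq (Q : K0[X]) (h : (abscissae Q).Nonempty) :
    (abscissae Q).card = numEdges Q + 1 := by
  have := h.card_pos
  rw [numEdges]
  omega

theorem vertexX_mem {Q : K0[X]} (h : (abscissae Q).Nonempty) {j : ℕ} (hj : j ≤ numEdges Q) :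
    vertexX Q j ∈ abscissae Q := by
  refine Nat.nth_mem (p := fun i => i ∈ abscissae Q) j fun hf => ?_
  have : hf.toFinset = abscissae Q := by ext; simp
  rw [this, card_abscissae_eq Q h]
  omega

theorem vertexX_lt {Q : K0[X]} (h : (abscissae Q).Nonempty) {i j : ℕ} (hij : i < j)
    (hj : j ≤ numEdges Q) : vertexX Q i < vertexX Q j := by
  refine Nat.nth_lt_nth' (p := fun i => i ∈ abscissae Q) hij fun hf => ?_
  have : hf.toFinset = abscissae Q := by ext; simp
  rw [this, card_abscissae_eq Q h]
  omega

theorem exists_vertexX_eq {Q : K0[X]} {i : ℕ} (hi : i ∈ abscissae Q) :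
    ∃ j ≤ numEdges Q, vertexX Q j = i := by
  obtain ⟨j, hj, h⟩ := Nat.exists_lt_card_nth_eq (p := fun i => i ∈ abscissae Q) hi
  have hf : {i | i ∈ abscissae Q}.Finite := (abscissae Q).finite_toSet
  have h1 := hj hf
  have : hf.toFinset = abscissae Q := by ext; simp
  rw [this, card_abscissae_eq Q ⟨i, hi⟩] at h1
  exact ⟨j, by omega, h⟩

theorem vertexX_consecutive {Q : K0[X]} {j : ℕ} (hj : j + 1 ≤ numEdges Q) :
    ∀ i ∈ abscissae Q, i ≤ vertexX Q j ∨ vertexX Q (j + 1) ≤ i := by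
  intro i hi
  have hne : (abscissae Q).Nonempty := ⟨i, hi⟩
  obtain ⟨k, hk, rfl⟩ := exists_vertexX_eq hi
  rcases Nat.lt_or_ge j k with h | h
  · right
    rcases (Nat.succ_le_of_lt h).lt_or_eq with h' | h'
    · exact (vertexX_lt hne h' hk).le
    · rw [← h']
  · left
    rcases h.lt_or_eq with h' | h'
    · exact (vertexX_lt hne h' (by omega)).le
    · rw [h']

/-! ### Supporting lines of a product of linear factors. -/

section Valuation

variable {R : Type*} [CommRing R] (v : AddValuation R (WithTop ℚ))

/-- The line `y = c - j * lam` supports the points `(j, v (p.coeff j))` from below and touches them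
at `j = A` and `j = B`, but not outside the interval `[A, B]`. -/
structure Touches (lam c : ℚ) (p : R[X]) (A B : ℕ) : Prop where
  le : ∀ j : ℕ, ((c - j * lam : ℚ) : WithTop ℚ) ≤ v (p.coeff j)
  lt : ∀ j : ℕ, j < A ∨ B < j → ((c - j * lam : ℚ) : WithTop ℚ) < v (p.coeff j)
  left : v (p.coeff A) = ((c - A * lam : ℚ) : WithTop ℚ)
  right : v (p.coeff B) = ((c - B * lam : ℚ) : WithTop ℚ)

variable {v} {lam c : ℚ} {p q : R[X]} {A B : ℕ}

theorem Touches.neg (h : Touches v lam c p A B) : Touches v lam c (-p) A B := by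
  constructor <;> simp only [coeff_neg, v.map_neg]
  exacts [h.le, h.lt, h.left, h.right]

theorem Touches.X_mul (h : Touches v lam c p A B) :
    Touches v lam (c + lam) (X * p) (A + 1) (B + 1) := by
  have key : ∀ j : ℕ, c + lam - ((j + 1 : ℕ) : ℚ) * lam = c - j * lam := fun j => by
    push_cast
    ring
  constructor
  · rintro (_ | j)
    · simp
    · rw [coeff_X_mul, key]
      exact h.le j
  · rintro (_ | j) hj
    · simp
    · rw [coeff_X_mul, key]
      exact h.lt j (by omega)
  · rw [coeff_X_mul, key]
    exact h.left
  · rw [coeff_X_mul, key]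
    exact h.right

theorem Touches.C_mul (h : Touches v lam c p A B) {r : R} {ρ : ℚ} (hr : v r = (ρ : WithTop ℚ)) :
    Touches v lam (c + ρ) (C r * p) A B := by
  have key : ∀ j : ℕ, ((c + ρ - j * lam : ℚ) : WithTop ℚ) =
      (ρ : WithTop ℚ) + ((c - j * lam : ℚ) : WithTop ℚ) := fun j => by
    rw [← WithTop.coe_add]
    congr 1
    ring
  constructor
  · intro j
    rw [coeff_C_mul, v.map_mul, hr, key]
    exact add_le_add_right (h.le j) _
  · intro j hj
    rw [coeff_C_mul, v.map_mul, hr, key]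
    exact WithTop.add_lt_add_left (WithTop.coe_ne_top) (h.lt j hj)
  · rw [coeff_C_mul, v.map_mul, hr, key, h.left]
  · rw [coeff_C_mul, v.map_mul, hr, key, h.right]

theorem Touches.add_of_lt (h : Touches v lam c p A B)
    (hq : ∀ j : ℕ, ((c - j * lam : ℚ) : WithTop ℚ) < v (q.coeff j)) :
    Touches v lam c (p + q) A B := by
  constructor
  · intro j
    rw [coeff_add]
    exact v.map_le_add (h.le j) (hq j).le
  · intro j hj
    rw [coeff_add]
    exact v.map_lt_add (h.lt j hj) (hq j)
  · rw [coeff_add, v.map_add_eq_of_lt_left (h.left ▸ hq A), h.left]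
  · rw [coeff_add, v.map_add_eq_of_lt_left (h.right ▸ hq B), h.right]

theorem Touches.lt_of_lt {c' : ℚ} (h : Touches v lam c' q A B) (hc : c < c') (j : ℕ) :
    ((c - j * lam : ℚ) : WithTop ℚ) < v (q.coeff j) :=
  lt_of_lt_of_le (WithTop.coe_lt_coe.2 (by linarith)) (h.le j)

/-- No cancellation occurs at the two ends: only `q` attains the line at `A'`, and only `p` at `B`.
-/
theorem Touches.add_of_interlace {A' B' : ℕ} (h : Touches v lam c p A B)
    (h' : Touches v lam c q A' B') (hA : A' < A) (hB : B' < B) :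
    Touches v lam c (p + q) A' B := by
  constructor
  · intro j
    rw [coeff_add]
    exact v.map_le_add (h.le j) (h'.le j)
  · intro j hj
    rw [coeff_add]
    exact v.map_lt_add (h.lt j (by omega)) (h'.lt j (by omega))
  · rw [coeff_add, v.map_add_eq_of_lt_right (h'.left ▸ h.lt A' (Or.inl hA)), h'.left]
  · rw [coeff_add, v.map_add_eq_of_lt_left (h.right ▸ h'.lt B (Or.inr hB)), h.right]

/-- The supporting line with slope `-lam` of a product of linear factors touches between the number
of roots of valuation greater than `lam` and the number of roots of valuation at least `lam`. -/
theorem exists_touches_prod (v : AddValuation R (WithTop ℚ)) (lam : ℚ) (S : Multiset R)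
    (hS : ∀ r ∈ S, v r ≠ ⊤) :
    ∃ c : ℚ, Touches v lam c (S.map fun r => X - C r).prod
      (S.countP fun r => (lam : WithTop ℚ) < v r) (S.countP fun r => (lam : WithTop ℚ) ≤ v r) := by
  induction S using Multiset.induction_on with
  | empty =>
    refine ⟨0, ?_⟩
    simp only [Multiset.map_zero, Multiset.prod_zero, Multiset.countP_zero]
    have h0 : ∀ j : ℕ, j ≠ 0 → v ((1 : R[X]).coeff j) = ⊤ := fun j hj => by
      rw [coeff_one, if_neg hj, v.map_zero]
    constructor
    · intro j
      rcases eq_or_ne j 0 with rfl | hj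
      · simp
      · simp [h0 j hj]
    · intro j hj
      rw [h0 j (by omega)]
      exact WithTop.coe_lt_top _
    · simp
    · simp
  | cons r S ih =>
    obtain ⟨c, h⟩ := ih fun x hx => hS x (Multiset.mem_cons_of_mem hx)
    obtain ⟨ρ, hρ⟩ := WithTop.ne_top_iff_exists.1 (hS r (Multiset.mem_cons_self r S))
    rw [Multiset.map_cons, Multiset.prod_cons, Multiset.countP_cons, Multiset.countP_cons, ← hρ]
    simp only [WithTop.coe_lt_coe, WithTop.coe_le_coe]
    have hX := h.X_mul
    have hC := (h.C_mul hρ.symm).neg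
    rw [sub_mul, sub_eq_add_neg]
    -- The lines of `X * p` and `C r * p` have constants `c + lam` and `c + ρ`. The lower one
    -- decides the contact interval; when they agree, the interval grows by one on the right.
    rcases lt_trichotomy lam ρ with hlt | rfl | hlt
    · rw [if_pos hlt, if_pos hlt.le]
      exact ⟨_, hX.add_of_lt fun j => hC.lt_of_lt (by linarith) j⟩
    · rw [if_neg (lt_irrefl _), if_pos le_rfl]
      exact ⟨_, hX.add_of_interlace hC (Nat.lt_succ_self _) (Nat.lt_succ_self _)⟩
    · rw [if_neg hlt.le.not_gt, if_neg hlt.not_ge, add_comm]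
      exact ⟨_, hC.add_of_lt fun j => hX.lt_of_lt (by linarith) j⟩

theorem Touches.unique {c' : ℚ} {A' B' : ℕ} (h : Touches v lam c p A B)
    (h' : Touches v lam c' p A' B') : A = A' ∧ B = B' := by
  have hle : ∀ {c c' : ℚ} {A B A' B' : ℕ}, Touches v lam c p A B → Touches v lam c' p A' B' →
      c ≤ c' := fun {c c' A B A' B'} h h' => by
    have := h.le A'
    rw [h'.left, WithTop.coe_le_coe] at this
    linarith
  obtain rfl : c = c' := le_antisymm (hle h h') (hle h' h)
  have h1 : ∀ {A B A' B' : ℕ}, Touches v lam c p A B → Touches v lam c p A' B' →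
      A ≤ A' ∧ B' ≤ B := fun {A B A' B'} h h' => by
    constructor
    · by_contra hlt
      exact (h.lt A' (Or.inl (not_le.1 hlt))).ne' h'.left
    · by_contra hlt
      exact (h.lt B' (Or.inr (not_le.1 hlt))).ne' h'.right
  have := h1 h h'
  have := h1 h' h
  omega

theorem card_filter_eq_of_touches [DecidablePred fun r => v r = (lam : WithTop ℚ)]
    {S : Multiset R} (hS : ∀ r ∈ S, v r ≠ ⊤)
    (h : Touches v lam c (S.map fun r => X - C r).prod A B) :
    Multiset.card (S.filter fun r => v r = (lam : WithTop ℚ)) = B - A := by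
  obtain ⟨c', h'⟩ := exists_touches_prod v lam S hS
  obtain ⟨rfl, rfl⟩ := h.unique h'
  rw [← Multiset.countP_eq_card_filter]
  -- What remains is a count: roots of valuation `≥ lam` minus those `> lam`. The subtraction is
  -- truncated, hence `hle` below.
  clear h h' hS
  induction S using Multiset.induction_on with
  | empty => simp
  | cons r S ih =>
    have hle : S.countP (fun r => (lam : WithTop ℚ) < v r) ≤
        S.countP (fun r => (lam : WithTop ℚ) ≤ v r) := by
      rw [Multiset.countP_eq_card_filter, Multiset.countP_eq_card_filter]
      exact Multiset.card_le_card (Multiset.monotone_filter_right S fun _ h => le_of_lt h)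
    rw [Multiset.countP_cons, Multiset.countP_cons, Multiset.countP_cons, ih]
    rcases lt_trichotomy (lam : WithTop ℚ) (v r) with hlt | heq | hlt
    · rw [if_neg hlt.ne', if_pos hlt, if_pos hlt.le]
      omega
    · rw [if_pos heq.symm, if_neg heq.not_lt, if_pos heq.le]
      omega
    · rw [if_neg hlt.ne, if_neg hlt.le.not_gt, if_neg hlt.not_ge]
      omega

end Valuation

/-! ### Orders and roots in fractional power series. -/

theorem order_le_order_dilate (a : ℂ) (f : K0) :
    (f : PowerSeries ℂ).order ≤ (dilate a f : PowerSeries ℂ).order := by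
  refine PowerSeries.le_order _ _ fun i hi => ?_
  rw [coeff_dilate, PowerSeries.coeff_of_lt_order i hi, mul_zero]

theorem order_dilate {a : ℂ} (ha : a ≠ 0) (f : K0) :
    (dilate a f : PowerSeries ℂ).order = (f : PowerSeries ℂ).order := by
  refine le_antisymm ?_ (order_le_order_dilate a f)
  have := order_le_order_dilate a⁻¹ (dilate a f)
  rwa [dilate_dilate, inv_mul_cancel₀ ha, dilate_one] at this

theorem dilate_injective {a : ℂ} (ha : a ≠ 0) : Function.Injective (dilate a) := by
  intro f g h
  have := congrArg (dilate a⁻¹) h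
  rwa [dilate_dilate, dilate_dilate, inv_mul_cancel₀ ha, dilate_one, dilate_one] at this

theorem orderTop_substRoot_dilate (n : ℕ) (hn : n ≠ 0) {a : ℂ} (ha : a ≠ 0) (f : K0) :
    (substRoot n hn (dilate a f) : HahnSeries ℚ ℂ).orderTop =
      (substRoot n hn f : HahnSeries ℚ ℂ).orderTop := by
  by_cases hf : f = 0
  · rw [hf, ← dilateHom_apply, map_zero]
  · have hd : dilate a f ≠ 0 := fun h => hf (dilate_injective ha (by
      rw [h, ← dilateHom_apply, map_zero]))
    rw [orderTop_substRoot n hn hf, orderTop_substRoot n hn hd, ord, order_dilate ha, ord]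

theorem map_toPuiseux (Q : K0[X]) (n : ℕ) (hn : n ≠ 0) :
    (Q.map (expand n hn)).map (substRoot n hn) = Q.map toPuiseux := by
  rw [Polynomial.map_map]
  congr 1
  exact RingHom.ext (substRoot_expand n hn)

theorem eq_prod_roots_toPuiseux {Q : K0[X]} {n : ℕ} {hn : n ≠ 0} {S : Multiset K0}
    (h : Q.map (expand n hn) = (S.map fun r => X - C r).prod) :
    Q.map toPuiseux = ((S.map (substRoot n hn)).map fun r => X - C r).prod := by
  rw [← map_toPuiseux Q n hn, h, Polynomial.map_multiset_prod, Multiset.map_map, Multiset.map_map]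
  simp

theorem roots_toPuiseux {Q : K0[X]} {n : ℕ} {hn : n ≠ 0} {S : Multiset K0}
    (h : Q.map (expand n hn) = (S.map fun r => X - C r).prod) :
    (Q.map toPuiseux).roots = S.map (substRoot n hn) := by
  rw [eq_prod_roots_toPuiseux h, roots_multiset_prod_X_sub_C]

/-- The order at `0`, as a valuation on fractional power series. -/
noncomputable def puiseuxVal : AddValuation Puiseux (WithTop ℚ) :=
  (HahnSeries.addVal ℚ ℂ).comap Puiseux.subtype

theorem puiseuxVal_apply (f : Puiseux) : puiseuxVal f = (f : HahnSeries ℚ ℂ).orderTop := rfl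

theorem puiseuxVal_ne_top {Q : K0[X]} (h0 : Q.coeff 0 ≠ 0) :
    ∀ r ∈ (Q.map toPuiseux).roots, puiseuxVal r ≠ ⊤ := by
  intro r hr htop
  rw [puiseuxVal_apply, HahnSeries.orderTop_eq_top] at htop
  obtain rfl : r = 0 := Subtype.ext htop
  have := isRoot_of_mem_roots hr
  rw [IsRoot, ← coeff_zero_eq_eval_zero, coeff_map] at this
  exact h0 (toPuiseux_injective (this.trans (map_zero _).symm))

theorem edgeLength_pos {Q : K0[X]} (h0 : Q.coeff 0 ≠ 0) {j : ℕ} (hj : j + 1 ≤ numEdges Q) :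
    0 < edgeLength Q (j + 1) :=
  Nat.sub_pos_of_lt (vertexX_lt ⟨0, zero_mem_abscissae h0⟩ (Nat.lt_succ_self j) hj)

/-- Translates the supporting line of an edge into valuations; vanishing coefficients have valuation
`⊤` and impose nothing. -/
theorem touches_edge {Q : K0[X]} (h0 : Q.coeff 0 ≠ 0) {j : ℕ} (hj : j + 1 ≤ numEdges Q) :
    ∃ c : ℚ, Touches puiseuxVal (-edgeSlope Q (j + 1)) c (Q.map toPuiseux)
      (vertexX Q j) (vertexX Q (j + 1)) := by
  have hne : (abscissae Q).Nonempty := ⟨0, zero_mem_abscissae h0⟩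
  have ha := vertexX_mem hne (show j ≤ numEdges Q by omega)
  have hb := vertexX_mem hne hj
  have hab := vertexX_lt hne (Nat.lt_succ_self j) hj
  have haS := (mem_abscissae.1 ha).1
  have hbS := (mem_abscissae.1 hb).1
  have hs : (vertexY Q (j + 1) : ℚ) - edgeSlope Q (j + 1) * vertexX Q (j + 1) =
      vertexY Q j - edgeSlope Q (j + 1) * vertexX Q j := by
    have h1 : (edgeLength Q (j + 1) : ℚ) = vertexX Q (j + 1) - vertexX Q j := by
      rw [edgeLength, Nat.add_sub_cancel, Nat.cast_sub hab.le]
    have h2 : (edgeLength Q (j + 1) : ℚ) ≠ 0 := by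
      exact_mod_cast (edgeLength_pos h0 hj).ne'
    have h3 : edgeSlope Q (j + 1) * edgeLength Q (j + 1) = vertexY Q (j + 1) - vertexY Q j := by
      rw [edgeSlope, Nat.add_sub_cancel, div_mul_cancel₀ _ h2]
    rw [h1] at h3
    linear_combination -h3
  have key := support_line_of_consecutive ha hb hab (vertexX_consecutive hj)
    (s := ((edgeSlope Q (j + 1) : ℚ) : ℝ)) (by exact_mod_cast hs)
  set s := edgeSlope Q (j + 1) with hsdef
  have hv : ∀ i ∈ Q.support, puiseuxVal ((Q.map toPuiseux).coeff i) =
      ((ord (Q.coeff i) : ℚ) : WithTop ℚ) := fun i hi => by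
    rw [coeff_map, puiseuxVal_apply, orderTop_toPuiseux (mem_support_iff.1 hi)]
  have hv0 : ∀ i, i ∉ Q.support → puiseuxVal ((Q.map toPuiseux).coeff i) = ⊤ := fun i hi => by
    rw [coeff_map, notMem_support_iff.1 hi, map_zero, AddValuation.map_zero]
  refine ⟨vertexY Q j - s * vertexX Q j, ?_, ?_, ?_, ?_⟩
  · intro i
    by_cases hi : i ∈ Q.support
    · rw [hv i hi, WithTop.coe_le_coe]
      have h1 : ((vertexY Q j : ℚ) - s * vertexX Q j) ≤ ord (Q.coeff i) - s * i := by
        exact_mod_cast (key i hi).1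
      linarith
    · rw [hv0 i hi]
      exact le_top
  · intro i hij
    by_cases hi : i ∈ Q.support
    · rw [hv i hi, WithTop.coe_lt_coe]
      have h1 : ((vertexY Q j : ℚ) - s * vertexX Q j) ≤ ord (Q.coeff i) - s * i := by
        exact_mod_cast (key i hi).1
      have h2 : (ord (Q.coeff i) : ℚ) - s * i ≠ (vertexY Q j : ℚ) - s * vertexX Q j := by
        intro h
        have := (key i hi).2 (by exact_mod_cast h)
        omega
      have := lt_of_le_of_ne h1 h2.symm
      linarith
    · rw [hv0 i hi]
      exact WithTop.coe_lt_top _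
  · rw [hv _ haS]
    congr 1
    rw [vertexY]
    ring
  · rw [hv _ hbS]
    congr 1
    rw [← hs, vertexY]
    ring

/-- The contact interval of a line of given slope is unique, so the one read off the edge agrees
with the one counting roots. -/
theorem card_edgeRoots {Q : K0[X]} (hQ : Q.Monic) (h0 : Q.coeff 0 ≠ 0) {j : ℕ}
    (hj : j + 1 ≤ numEdges Q) :
    Multiset.card (edgeRoots Q (j + 1)) = edgeLength Q (j + 1) := by
  classical
  obtain ⟨n, hn, hsplit⟩ := exists_splits_expand hQ
  obtain ⟨c, hc⟩ := touches_edge h0 hj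
  have h := hsplit.map (substRoot n hn)
  rw [map_toPuiseux] at h
  rw [h.eq_prod_roots_of_monic (hQ.map _)] at hc
  have := card_filter_eq_of_touches (puiseuxVal_ne_top h0) hc
  rw [edgeLength, Nat.add_sub_cancel, ← this, edgeRoots]
  congr!

/-! ### Descent under roots of unity and the irreducible case. -/

theorem exists_map_expand_eq_prod {n : ℕ} (hn : n ≠ 0) {ζ : ℂ} (hζ : IsPrimitiveRoot ζ n)
    {S : Multiset K0} (hS : S.map (dilate ζ) = S) :
    ∃ F : K0[X], F.map (expand n hn) = (S.map fun r => X - C r).prod := by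
  have hinv : ((S.map fun r => X - C r).prod).map (dilateHom ζ) =
      (S.map fun r => X - C r).prod := by
    conv_rhs => rw [← hS]
    rw [Polynomial.map_multiset_prod, Multiset.map_map, Multiset.map_map]
    simp
  have hl : (S.map fun r => X - C r).prod ∈ Polynomial.lifts (expand n hn) := by
    rw [lifts_iff_coeff_lifts]
    intro k
    refine exists_expand_eq_of_dilate_eq hn hζ ?_
    rw [← dilateHom_apply, ← coeff_map, hinv]
  obtain ⟨F, hF⟩ := (mem_lifts _).1 hl
  exact ⟨F, hF⟩

/-- The coefficients are series in `t ^ n`, hence fixed by `t ↦ ζ t`, so the roots are permuted. -/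
theorem map_dilate_roots {Q : K0[X]} {n : ℕ} {hn : n ≠ 0} {ζ : ℂ} (hζ : IsPrimitiveRoot ζ n)
    {S : Multiset K0} (h : Q.map (expand n hn) = (S.map fun r => X - C r).prod) :
    S.map (dilate ζ) = S := by
  have h1 : (Q.map (expand n hn)).map (dilateHom ζ) = Q.map (expand n hn) := by
    rw [Polynomial.map_map]
    congr 1
    refine RingHom.ext fun f => ?_
    rw [RingHom.comp_apply, dilateHom_apply, dilate_expand, hζ.pow_eq_one, dilate_one]
  have h2 : ((S.map (dilate ζ)).map fun r => X - C r).prod = (S.map fun r => X - C r).prod := by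
    rw [← h, ← h1, h, Polynomial.map_multiset_prod, Multiset.map_map, Multiset.map_map]
    simp
  have h3 := congrArg roots h2
  rwa [roots_multiset_prod_X_sub_C, roots_multiset_prod_X_sub_C] at h3

theorem exists_eq_prod_edgeRoots {Q : K0[X]} (hQ : Q.Monic) (j : ℕ) :
    ∃ F : K0[X], F.map toPuiseux = ((edgeRoots Q j).map fun r => X - C r).prod := by
  classical
  obtain ⟨n, hn, hsplit⟩ := exists_splits_expand hQ
  have h := hsplit.eq_prod_roots_of_monic (hQ.map _)
  set S := (Q.map (expand n hn)).roots
  have hζ := Complex.isPrimitiveRoot_exp n hn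
  set ζ := Complex.exp (2 * Real.pi * Complex.I / n)
  have hζ0 : ζ ≠ 0 := Complex.exp_ne_zero _
  set μ : WithTop ℚ := ((-edgeSlope Q j : ℚ) : WithTop ℚ) with hμ
  set T := S.filter fun r => (substRoot n hn r : HahnSeries ℚ ℂ).orderTop = μ with hT
  -- Dilation preserves the order, so it permutes the roots of each given order.
  have hTinv : T.map (dilate ζ) = T := by
    have h1 := map_dilate_roots hζ h
    conv_rhs => rw [hT, ← h1, Multiset.filter_map]
    congr 1
    refine Multiset.filter_congr fun r _ => ?_
    rw [Function.comp_apply, orderTop_substRoot_dilate n hn hζ0]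
  obtain ⟨F, hF⟩ := exists_map_expand_eq_prod hn hζ hTinv
  refine ⟨F, ?_⟩
  rw [eq_prod_roots_toPuiseux hF]
  have : edgeRoots Q j = T.map (substRoot n hn) := by
    rw [edgeRoots, roots_toPuiseux h, Multiset.filter_map]
    congr!
  rw [this]

/-- The roots of an irreducible polynomial form a single orbit under the substitution of `ζ t` for
`t`, where `ζ` is a root of unity. -/
theorem exists_roots_eq_orbit {Q : K0[X]} (hQ : Q.Monic) (hirr : Irreducible Q)
    (hm : 0 < Q.natDegree) : ∃ η : K0, (Q.map toPuiseux).roots =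
      (Finset.Icc 1 Q.natDegree).val.map fun l : ℕ => substRoot Q.natDegree hm.ne'
        (dilate (Complex.exp (2 * Real.pi * Complex.I * l / Q.natDegree)) η) := by
  classical
  obtain ⟨n, hn, hsplit⟩ := exists_splits_expand hQ
  have h := hsplit.eq_prod_roots_of_monic (hQ.map _)
  have hcard : Multiset.card (Q.map (expand n hn)).roots = Q.natDegree := by
    rw [← hsplit.natDegree_eq_card_roots, hQ.natDegree_map]
  set S := (Q.map (expand n hn)).roots
  have hζ := Complex.isPrimitiveRoot_exp n hn
  set ζ := Complex.exp (2 * Real.pi * Complex.I / n) with hζd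
  have hζ0 : ζ ≠ 0 := Complex.exp_ne_zero _
  have hSinv := map_dilate_roots hζ h
  obtain ⟨η₀, hη₀⟩ := Multiset.card_pos_iff_exists_mem.1 (hcard ▸ hm)
  have hiter : ∀ l : ℕ, (dilate ζ)^[l] η₀ = dilate (ζ ^ l) η₀ := fun l =>
    iterate_dilateHom ζ l η₀
  have hper : Function.IsPeriodicPt (dilate ζ) n η₀ := by
    rw [Function.IsPeriodicPt, Function.IsFixedPt, hiter, hζ.pow_eq_one, dilate_one]
  set d := Function.minimalPeriod (dilate ζ) η₀ with hd
  have hdpos : 0 < d := hper.minimalPeriod_pos (Nat.pos_of_ne_zero hn)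
  set T : Multiset K0 := (Multiset.range d).map fun l => (dilate ζ)^[l] η₀ with hT
  have hTnodup : T.Nodup := by
    refine Multiset.Nodup.map_on ?_ (Multiset.nodup_range d)
    intro x hx y hy hxy
    exact Function.iterate_injOn_Iio_minimalPeriod (Multiset.mem_range.1 hx)
      (Multiset.mem_range.1 hy) hxy
  have hTinv : T.map (dilate ζ) = T := by
    refine Multiset.eq_of_le_of_card_le ?_ (Multiset.card_map _ _).ge
    refine (Multiset.le_iff_subset (hTnodup.map (dilate_injective hζ0))).2 ?_
    intro x hx
    obtain ⟨y, hy, rfl⟩ := Multiset.mem_map.1 hx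
    obtain ⟨l, hl, rfl⟩ := Multiset.mem_map.1 hy
    rw [Multiset.mem_range] at hl
    rw [← Function.iterate_succ_apply' (dilate ζ) l η₀]
    rcases (Nat.succ_le_of_lt hl).lt_or_eq with h' | h'
    · exact Multiset.mem_map.2 ⟨_, Multiset.mem_range.2 h', rfl⟩
    · refine Multiset.mem_map.2 ⟨0, Multiset.mem_range.2 hdpos, ?_⟩
      rw [h', hd, Function.iterate_minimalPeriod, Function.iterate_zero, id]
  have horb : ∀ l : ℕ, (dilate ζ)^[l] η₀ ∈ S := fun l => by
    induction l with
    | zero => exact hη₀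
    | succ l ih =>
      rw [Function.iterate_succ_apply', ← hSinv]
      exact Multiset.mem_map_of_mem _ ih
  have hTS : T ≤ S := by
    refine (Multiset.le_iff_subset hTnodup).2 fun x hx => ?_
    obtain ⟨l, -, rfl⟩ := Multiset.mem_map.1 hx
    exact horb l
  -- The orbit descends to a monic divisor of `Q` of positive degree `d`; irreducibility forces it
  -- to be `Q`, so `d` is the degree.
  obtain ⟨F, hF⟩ := exists_map_expand_eq_prod hn hζ hTinv
  have hFm : F.Monic := by
    refine monic_of_injective (expand_injective n hn) ?_
    rw [hF]
    exact monic_multiset_prod_of_monic _ _ fun r _ => monic_X_sub_C r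
  have hFd : F.natDegree = d := by
    rw [← hFm.natDegree_map (expand n hn), hF, natDegree_multiset_prod_X_sub_C_eq_card,
      Multiset.card_map, Multiset.card_range]
  have hdvd : F ∣ Q := by
    rw [← map_dvd_map (expand n hn) (expand_injective n hn) hFm, hF, h]
    exact Multiset.prod_dvd_prod_of_le (Multiset.map_le_map hTS)
  have hFQ : F = Q := by
    refine eq_of_monic_of_associated hFm hQ ?_
    refine ((hirr.dvd_iff.1 hdvd).resolve_left fun hu => ?_).symm
    rw [hFm.isUnit_iff] at hu
    rw [hu, natDegree_one] at hFd
    omega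
  have hdm : d = Q.natDegree := by rw [← hFd, hFQ]
  have hST : S = T := (Multiset.eq_of_le_of_card_le hTS (by
    rw [hcard, ← hdm, hT, Multiset.card_map, Multiset.card_range])).symm
  obtain ⟨k, hk⟩ := hper.minimalPeriod_dvd
  rw [← hd, hdm] at hk
  have hk0 : k ≠ 0 := by
    rintro rfl
    exact hn (by simpa using hk)
  -- With `n = Q.natDegree * k`, this power of `ζ` is a primitive `k`-th root of unity, so `η₀` is a
  -- series in `t ^ k`.
  have hfix : dilate (ζ ^ Q.natDegree) η₀ = η₀ := by
    rw [← hiter, ← hdm, hd, Function.iterate_minimalPeriod]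
  obtain ⟨η, hη⟩ := exists_expand_eq_of_dilate_eq hk0
    (hζ.pow (Nat.pos_of_ne_zero hn) hk) hfix
  refine ⟨η, ?_⟩
  have hIcc : (Finset.range d).map (addRightEmbedding 1) = Finset.Icc 1 Q.natDegree := by
    rw [← hdm]
    ext x
    simp only [Finset.mem_map, Finset.mem_range, addRightEmbedding_apply, Finset.mem_Icc]
    exact ⟨by rintro ⟨y, hy, rfl⟩; omega, fun hx => ⟨x - 1, by omega, by omega⟩⟩
  -- Applying `hTinv` once shifts the orbit index from `0, …, d - 1` to `1, …, d`.
  rw [roots_toPuiseux h, hST, ← hTinv, hT, ← hIcc, Finset.map_val, Finset.range_val,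
    Multiset.map_map, Multiset.map_map, Multiset.map_map]
  refine Multiset.map_congr rfl fun l _ => ?_
  simp only [Function.comp_apply, addRightEmbedding_apply]
  rw [← Function.iterate_succ_apply' (dilate ζ) l η₀, hiter, ← hη, dilate_expand, ← pow_mul]
  have hexp : ζ ^ ((l + 1) * k) =
      Complex.exp (2 * Real.pi * Complex.I * ((l + 1 : ℕ) : ℂ) / Q.natDegree) := by
    rw [hζd, ← Complex.exp_nat_mul, hk]
    congr 1
    have h1 : (k : ℂ) ≠ 0 := Nat.cast_ne_zero.2 hk0
    have h2 : (Q.natDegree : ℂ) ≠ 0 := Nat.cast_ne_zero.2 hm.ne'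
    push_cast
    field_simp
  rw [hexp, ← substRoot_mul_expand Q.natDegree k hm.ne' hk0]
  congr! 1
  simp only [hk]

/-- The first edge has positive length, so it carries a root, hence all of them; its length is then
the full degree and leaves no room for another edge. -/
theorem edge_of_orderTop_eq {Q : K0[X]} (hQ : Q.Monic) (hm : 0 < Q.natDegree)
    (h0 : Q.coeff 0 ≠ 0) {μ : WithTop ℚ}
    (h : ∀ r ∈ (Q.map toPuiseux).roots, (r : HahnSeries ℚ ℂ).orderTop = μ) :
    numEdges Q = 1 ∧ vertexX Q 0 = 0 ∧ vertexX Q 1 = Q.natDegree ∧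
      edgeRoots Q 1 = (Q.map toPuiseux).roots ∧
      μ = (((ord (Q.coeff 0) : ℚ) / Q.natDegree : ℚ) : WithTop ℚ) := by
  have hzero := zero_mem_abscissae h0
  have hne : (abscissae Q).Nonempty := ⟨0, hzero⟩
  have hdeg := natDegree_mem_abscissae hQ
  have hk : 0 + 1 ≤ numEdges Q := by
    have : 1 < (abscissae Q).card := Finset.one_lt_card.2 ⟨0, hzero, _, hdeg, hm.ne⟩
    rw [card_abscissae_eq Q hne] at this
    omega
  have hle : ∀ i ≤ numEdges Q, vertexX Q i ≤ Q.natDegree := fun i hi =>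
    le_natDegree_of_mem_supp _ (mem_abscissae.1 (vertexX_mem hne hi)).1
  have hcard := card_edgeRoots hQ h0 hk
  obtain ⟨r, hr⟩ := Multiset.card_pos_iff_exists_mem.1 (hcard ▸ edgeLength_pos h0 hk)
  obtain ⟨hr1, hr2⟩ := Multiset.mem_filter.1 hr
  have hμ : μ = ((-edgeSlope Q 1 : ℚ) : WithTop ℚ) := (h r hr1).symm.trans hr2
  have hall : edgeRoots Q 1 = (Q.map toPuiseux).roots :=
    Multiset.filter_eq_self.2 fun x hx => (h x hx).trans hμ
  have hlen : edgeLength Q 1 = Q.natDegree := by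
    rw [← hcard, zero_add, hall]
    obtain ⟨n, hn, hsplit⟩ := exists_splits_expand hQ
    have h1 := hsplit.map (substRoot n hn)
    rw [map_toPuiseux] at h1
    rw [← h1.natDegree_eq_card_roots, hQ.natDegree_map]
  have h1 := hle 1 hk
  have hlen' : vertexX Q 1 - vertexX Q 0 = Q.natDegree := hlen
  have hx0 : vertexX Q 0 = 0 := by omega
  have hx1 : vertexX Q 1 = Q.natDegree := by omega
  refine ⟨?_, hx0, hx1, hall, ?_⟩
  · by_contra hne1
    have h2 := vertexX_lt hne (show 1 < 2 by norm_num) (by omega : 2 ≤ numEdges Q)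
    have := hle 2 (by omega)
    omega
  · rw [hμ, edgeSlope, hlen, vertexY, vertexY, hx0, hx1, hQ.coeff_natDegree, ord_one]
    congr 1
    push_cast
    ring

end NewtonPuiseux

theorem corollary3 (Q : Polynomial NewtonPuiseux.K0) (hQ : Q.Monic) (hm : 0 < Q.natDegree)
    (h0 : Q.coeff 0 ≠ 0) :
    (Irreducible Q →
      NewtonPuiseux.numEdges Q = 1 ∧
      NewtonPuiseux.edgeLength Q 1 = Q.natDegree ∧
      ∃ (η : NewtonPuiseux.K0) (ρ : ℕ → NewtonPuiseux.Puiseux),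
        η ≠ 0 ∧
        NewtonPuiseux.ord η = NewtonPuiseux.ord (Q.coeff 0) ∧
        (NewtonPuiseux.ord η : ℤ) = NewtonPuiseux.vertexY Q 0 - NewtonPuiseux.vertexY Q 1 ∧
        Q.map NewtonPuiseux.toPuiseux =
          ∏ l ∈ Finset.Icc 1 Q.natDegree, (Polynomial.X - Polynomial.C (ρ l)) ∧
        NewtonPuiseux.edgeRoots Q 1 = (Finset.Icc 1 Q.natDegree).val.map ρ ∧
        ∀ l ∈ Finset.Icc 1 Q.natDegree,
          NewtonPuiseux.substPow Q.natDegree hm (ρ l) =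
            NewtonPuiseux.toPuiseux (NewtonPuiseux.dilate
              (Complex.exp (2 * Real.pi * Complex.I * l / Q.natDegree)) η)) ∧
    ∀ j ∈ Finset.Icc 1 (NewtonPuiseux.numEdges Q),
      Multiset.card (NewtonPuiseux.edgeRoots Q j) = NewtonPuiseux.edgeLength Q j ∧
      ∃ F : Polynomial NewtonPuiseux.K0,
        F.map NewtonPuiseux.toPuiseux =
          ((NewtonPuiseux.edgeRoots Q j).map fun r => Polynomial.X - Polynomial.C r).prod := by
  open NewtonPuiseux in
  constructor
  · intro hirr
    obtain ⟨η, hη⟩ := exists_roots_eq_orbit hQ hirr hm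
    set ρ : ℕ → Puiseux := fun l => substRoot Q.natDegree hm.ne'
      (dilate (Complex.exp (2 * Real.pi * Complex.I * l / Q.natDegree)) η) with hρ
    have horder : ∀ r ∈ (Q.map toPuiseux).roots, (r : HahnSeries ℚ ℂ).orderTop =
        (substRoot Q.natDegree hm.ne' η : HahnSeries ℚ ℂ).orderTop := by
      intro r hr
      rw [hη] at hr
      obtain ⟨l, -, rfl⟩ := Multiset.mem_map.1 hr
      exact orderTop_substRoot_dilate _ _ (Complex.exp_ne_zero _) η
    obtain ⟨hk, hx0, hx1, hroots, hμ⟩ := edge_of_orderTop_eq hQ hm h0 horder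
    have hη0 : η ≠ 0 := by
      rintro rfl
      rw [map_zero, ZeroMemClass.coe_zero, HahnSeries.orderTop_zero] at hμ
      exact WithTop.coe_ne_top hμ.symm
    -- The common order of the roots is `ord η / m` by ramification and `ord q_0 / m` by the slope.
    have hord : ord η = ord (Q.coeff 0) := by
      have hm' : (Q.natDegree : ℚ) ≠ 0 := Nat.cast_ne_zero.2 hm.ne'
      rw [orderTop_substRoot _ _ hη0, WithTop.coe_inj, div_left_inj' hm', Nat.cast_inj] at hμ
      exact hμ
    refine ⟨hk, ?_, η, ρ, hη0, hord, ?_, ?_, ?_, fun l _ => substPow_substRoot _ hm _⟩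
    · rw [edgeLength, hx1, hx0, Nat.sub_zero]
    · rw [vertexY, vertexY, hx0, hx1, hQ.coeff_natDegree, ord_one, hord]
      simp
    · obtain ⟨n, hn, hsplit⟩ := exists_splits_expand hQ
      have h1 := hsplit.map (substRoot n hn)
      rw [map_toPuiseux] at h1
      rw [h1.eq_prod_roots_of_monic (hQ.map _), hη, Multiset.map_map]
      rfl
    · rw [hroots, hη]
  · intro j hj
    rw [Finset.mem_Icc] at hj
    obtain ⟨i, rfl⟩ : ∃ i, j = i + 1 := ⟨j - 1, by omega⟩
    exact ⟨card_edgeRoots hQ h0 hj.2, exists_eq_prod_edgeRoots hQ _⟩
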